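/- Let $\mathsf{PId}$, $\mathbb M$, $\mathbb D$ be countably infinite sets of site names, methods and data values. An \emph{execution} is a finite word over $\mathsf{PId}\times\mathbb M\times\mathbb D\times\mathbb D$, a letter $(p,m,\mathit{arg},\mathit{rv})$ standing for a call of $m$ with argument $\mathit{arg}$ on site $p$ that returns $\mathit{rv}$. An \emph{implementation} is a prefix-closed set of executions, and a \emph{specification} is a set of finite words over $\mathbb M\times\mathbb D\times\mathbb D$. The \emph{history} of an execution $e$ is $(O,\mathsf{PO},\ell)$, where $O$ is the set of positions of $e$, $\ell(o)=(m,\mathit{arg},\mathit{rv})$ is the label of $o$ without its site, and $o_1<_{\mathsf{PO}}o_2$ iff $o_1,o_2$ are on the same site and $o_1$ occurs before $o_2$ in $e$. For a strict partial order $r$ on $O$ and sets $A,K\subseteq O$, say that $(A,r,K)$ is \emph{explained} by $S$ if there is an enumeration of $A$ without repetition that respects $r$ and a word of $S$ of the same length such that, at each position, the letter of the word has the same method and argument as $\ell(o)$ for the operation $o$ enumerated there, and also the same return value if $o\in K$. For a relation $\mathit{co}$ on $O$ put $\mathrm{CausalPast}(o)=\{o' : o'<_{\mathit{co}}o \text{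 or } o'=o\}$ and $\mathrm{POPast}(o)=\{o' : o'<_{\mathsf{PO}}o\text{ or }o'=o\}$. With respect to $S$, the history (and the execution) is - CC (causally consistent) if there is a strict partial order $\mathit{co}\supseteq\mathsf{PO}$ such that $(\mathrm{CausalPast}(o),\mathit{co},\{o\})$ is explained by $S$ for every $o\in O$; - CM (causal memory) if there is a strict partial order $\mathit{co}\supseteq\mathsf{PO}$ such that $(\mathrm{CausalPast}(o),\mathit{co},\mathrm{POPast}(o))$ is explained by $S$ for every $o\in O$; - CCv (causally convergent) if there are a strict partial order $\mathit{co}\supseteq\mathsf{PO}$ and a strict total order $\mathit{arb}\supseteq\mathit{co}$ such that $(\mathrm{CausalPast}(o),\mathit{arb},\{o\})$ is explained by $S$ for every $o\in O$. **Theorem.** For each criterion $C\in\{\mathrm{CC},\mathrm{CM},\mathrm{CCv}\}$ the following problem is undecidable: given an implementation $\mathcal I$ and a specification $S$ that are regular languages (over finite alphabets, given by nondeterministic finite automata), do all executions of $\mathcal I$ satisfy $C$ with respect to $S$? It is undecidable even for implementations whose executions use only two fixed sites. (Undecidable means that no algorithm halts with the right answer on all such inputs.) -/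

import Mathlib

/-! ## Labeled posets -/

/-- A strict partial order. -/
def IsStrictPO {O : Type} (r : O → O → Prop) : Prop :=
  (∀ a, ¬ r a a) ∧ ∀ a b c, r a b → r b c → r a c

/-- A strict total order. -/
def IsStrictTO {O : Type} (r : O → O → Prop) : Prop :=
  IsStrictPO r ∧ ∀ a b, a ≠ b → r a b ∨ r b a

/-- A `Λ`-labeled poset with underlying set `O`. -/
structure LPoset (O Λ : Type) where
  lt : O → O → Prop
  label : O → Λ
  isStrictPO : IsStrictPO lt

/-- The label of an operation: method, argument, return value. -/
abbrev OpLabel (M D : Type) : Type := M × D × D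

/-- An operation label whose return value may be missing: `(m, arg, none)` is the label `(m, arg)`,
and `(m, arg, some rv)` is the label `(m, arg, rv)`. -/
abbrev PartialLabel (M D : Type) : Type := M × D × Option D

namespace LPoset

/-- The labeled poset in which only the return values of the operations in `K` are kept. -/
noncomputable def keepReturns {O M D : Type} (ρ : LPoset O (OpLabel M D)) (K : Set O) :
    LPoset O (PartialLabel M D) where
  lt := ρ.lt
  label := by
    classical
    exact fun o =>
      if o ∈ K then ((ρ.label o).1, (ρ.label o).2.1, some (ρ.label o).2.2)
      else ((ρ.label o).1, (ρ.label o).2.1, none)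
  isStrictPO := ρ.isStrictPO

/-- A fully labeled poset seen as one labeled by partial labels. -/
def full {O M D : Type} (ρ : LPoset O (OpLabel M D)) : LPoset O (PartialLabel M D) where
  lt := ρ.lt
  label o := ((ρ.label o).1, (ρ.label o).2.1, some (ρ.label o).2.2)
  isStrictPO := ρ.isStrictPO

/-- The relation `ρ₁ ⪯ ρ₂`: on the same set of operations, `ρ₁` has fewer order constraints, and
each label of `ρ₁` is that of `ρ₂`, possibly with the return value missing. -/
def Weaker {O M D : Type} (ρ₁ ρ₂ : LPoset O (PartialLabel M D)) : Prop :=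
  (∀ a b, ρ₁.lt a b → ρ₂.lt a b) ∧
  ∀ o, ρ₂.label o = ρ₁.label o ∨
    ∃ m arg rv, ρ₂.label o = (m, arg, some rv) ∧ ρ₁.label o = (m, arg, none)

/-- `ρ` is a (finite) sequence, and its labels, read in increasing order, form the word `w`. -/
def IsSequence {O Λ : Type} (ρ : LPoset O Λ) (w : List Λ) : Prop :=
  ∃ e : Fin w.length ≃ O,
    (∀ i j, ρ.lt (e i) (e j) ↔ i < j) ∧ ∀ i, ρ.label (e i) = w.get i

end LPoset

/-! ## Histories and specifications -/

/-- A history: operations labeled by methods, arguments and return values, and a program order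
that is a union of total orders, one for each site. -/
structure History (M D : Type) where
  Op : Type
  po : Op → Op → Prop
  label : Op → OpLabel M D
  po_strict : IsStrictPO po
  po_sites : ∃ (P : Type) (site : Op → P),
    (∀ a b, po a b → site a = site b) ∧
    ∀ a b, site a = site b → a ≠ b → po a b ∨ po b a

/-- A specification: a set of finite sequences of labeled operations. -/
abbrev Spec (M D : Type) : Type := Language (OpLabel M D)

/-- The labeled sequential poset `ρ` belongs to the specification `S`. -/
def Spec.Contains {O M D : Type} (S : Spec M D) (ρ : LPoset O (OpLabel M D)) : Prop :=
  ∃ w ∈ S, ρ.IsSequence w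

namespace History

variable {M D : Type}

/-- The causal past of `o`: the operations that are equal to `o` or before `o` in `co`. -/
def causalPast (h : History M D) (co : h.Op → h.Op → Prop) (o : h.Op) : Set h.Op :=
  {x | co x o ∨ x = o}

/-- The operations that are equal to `o` or before `o` in program order. -/
def poPast (h : History M D) (o : h.Op) : Set h.Op :=
  {x | h.po x o ∨ x = o}

/-- The restriction of the labeled poset `(O, r, ℓ)` to the set `A` of operations. -/
def restrict (h : History M D) (r : h.Op → h.Op → Prop) (hr : IsStrictPO r) (A : Set h.Op) :
    LPoset A (OpLabel M D) where
  lt a b := r a b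
  label a := h.label a
  isStrictPO := ⟨fun a => hr.1 a, fun a b c => hr.2 a b c⟩

/-- The labeled poset `(A, r, ℓ)`, in which only the return values of the operations in `K` are
kept, can be sequentialized to a sequence in `S`. -/
def Explained (h : History M D) (S : Spec M D) (r : h.Op → h.Op → Prop) (hr : IsStrictPO r)
    (A K : Set h.Op) : Prop :=
  ∃ ρ : LPoset A (OpLabel M D), S.Contains ρ ∧
    ((h.restrict r hr A).keepReturns {a | (a : h.Op) ∈ K}).Weaker ρ.full

/-- Causal consistency. -/
def IsCC (h : History M D) (S : Spec M D) : Prop :=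
  ∃ (co : h.Op → h.Op → Prop) (hco : IsStrictPO co),
    (∀ a b, h.po a b → co a b) ∧
    ∀ o, h.Explained S co hco (h.causalPast co o) {o}

/-- Causal memory. -/
def IsCM (h : History M D) (S : Spec M D) : Prop :=
  ∃ (co : h.Op → h.Op → Prop) (hco : IsStrictPO co),
    (∀ a b, h.po a b → co a b) ∧
    ∀ o, h.Explained S co hco (h.causalPast co o) (h.poPast o)

/-- Causal convergence. -/
def IsCCv (h : History M D) (S : Spec M D) : Prop :=
  ∃ (co arb : h.Op → h.Op → Prop) (_ : IsStrictPO co) (harb : IsStrictTO arb),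
    (∀ a b, h.po a b → co a b) ∧
    (∀ a b, co a b → arb a b) ∧
    ∀ o, h.Explained S arb harb.1 (h.causalPast co o) {o}

end History

/-- The three variants of causal consistency. -/
inductive Criterion where
  | CC
  | CM
  | CCv

/-- The history `h` satisfies the given criterion with respect to `S`. -/
def Criterion.Holds {M D : Type} (c : Criterion) (h : History M D) (S : Spec M D) : Prop :=
  match c with
  | .CC => h.IsCC S
  | .CM => h.IsCM S
  | .CCv => h.IsCCv S

/-! ## Executions and implementations -/

/-- The label `(site, method, argument, return value)` of an operation in an execution. -/
abbrev ExecLabel (P M D : Type) : Type := P × OpLabel M D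

/-- The history of an execution: operations are the positions of the execution, and two of them
are ordered by program order if they are on the same site, in the order of the execution. -/
def execHistory {P M D : Type} (e : List (ExecLabel P M D)) : History M D where
  Op := Fin e.length
  po i j := (e.get i).1 = (e.get j).1 ∧ i < j
  label i := (e.get i).2
  po_strict := ⟨fun _ h => lt_irrefl _ h.2,
    fun _ _ _ h₁ h₂ => ⟨h₁.1.trans h₂.1, h₁.2.trans h₂.2⟩⟩
  po_sites := ⟨P, fun i => (e.get i).1, fun _ _ h => h.1, fun _ _ h hne =>
    (lt_or_gt_of_ne hne).imp (fun hl => ⟨h, hl⟩) (fun hl => ⟨h.symm, hl⟩)⟩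

/-- An implementation is a prefix-closed set of executions. -/
def IsImplementation {P M D : Type} (I : Language (ExecLabel P M D)) : Prop :=
  ∀ e₁ e₂, e₁ ++ e₂ ∈ I → e₁ ∈ I

/-! ## Regular languages as inputs of algorithms -/

/-- A (nondeterministic) finite automaton over letters from `A`, as a finite object: the list of
initial states, the list of transitions `(q, a, r)`, and the list of accepting states. Its states
are the finitely many natural numbers that occur in these lists, and its alphabet is the finite set
of letters that occur in its transitions. -/
abbrev FinAutomaton (A : Type) : Type := List ℕ × List (ℕ × A × ℕ) × List ℕ

/-- The automaton as a Mathlib `NFA`. -/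
def FinAutomaton.toNFA {A : Type} (𝒜 : FinAutomaton A) : NFA A ℕ where
  start := {q | q ∈ 𝒜.1}
  step q a := {r | (q, a, r) ∈ 𝒜.2.1}
  accept := {q | q ∈ 𝒜.2.2}

/-- The regular language accepted by the automaton. -/
def FinAutomaton.language {A : Type} (𝒜 : FinAutomaton A) : Language A :=
  𝒜.toNFA.accepts

/-- Inputs: an automaton for the implementation and one for the specification. Sites, methods and
data values are natural numbers, of which each input uses finitely many. -/
abbrev Input : Type := FinAutomaton (ExecLabel ℕ ℕ ℕ) × FinAutomaton (OpLabel ℕ ℕ)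

/-- All executions of the implementation satisfy the criterion with respect to the
specification. -/
def AllExecutions (c : Criterion) (x : Input) : Prop :=
  ∀ e ∈ x.1.language, c.Holds (execHistory e) x.2.language

/-- The first component of the input is the automaton of an implementation. -/
def ValidInput (x : Input) : Prop :=
  IsImplementation x.1.language

/-- The implementation runs on two sites, numbered `0` and `1`. -/
def TwoSites (x : Input) : Prop :=
  ∀ e ∈ x.1.language, ∀ a ∈ e, a.1 = 0 ∨ a.1 = 1

/-- The problem "does `Q x` hold?", for inputs `x` that satisfy `V`, is decidable: some algorithm
halts with the right answer on every input that satisfies `V`. -/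
def DecidableOn {α : Type} [Primcodable α] (V Q : α → Prop) : Prop :=
  ∃ f : α →. Bool, Partrec f ∧ ∀ x, V x → ∃ b ∈ f x, (b = true ↔ Q x)

/-!
The halting problem is reduced to the complement of each of the three problems. Counter machines
are written as regular expressions over increments, decrements and zero tests of integer counters:
a partial recursive function `f` has such a program with a run from the counter values `(n, 0, …)`
to zero iff `f n` is defined. Putting `n` increments in front of the program, which is a computable
operation on automata, turns `n` into part of the implementation.

The implementation performs the instructions of the program, the site `0` the increments and the
site `1` the decrements, and the zero tests on both. A sequence of instructions leads from zero to
zero iff for every counter the two sites perform the same sequence of counting operations and zero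
tests. The language of the correct sequences of instructions is not regular, but their violation can
be tested by a finite automaton on a suitable interleaving of the two sites, which matches the
operations on one counter in pairs up to the first mismatch. The specification asks for such an
interleaving, and causal consistency allows any interleaving to be chosen, because it retains only
the order on each site. Hence an execution is consistent iff its sequence of instructions is not a
run.
-/

/-! ## Regular languages and finite automata -/

section RegularLanguages

variable {α β : Type*} {K L : Language α}

open Language
open scoped Computability

theorem isRegular_of_finite_closed {T : Set (Language α)} (hT : T.Finite) (hL : L ∈ T)
    (h : ∀ K ∈ T, ∀ a, K.leftQuotient [a] ∈ T) : L.IsRegular := by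
  refine .of_finite_range_leftQuotient (hT.subset ?_)
  rintro _ ⟨x, rfl⟩
  induction x using List.reverseRecOn with
  | nil => exact hL
  | append_singleton x a ih => rw [leftQuotient_append]; exact h _ ih a

theorem leftQuotient_mul_singleton (K L : Language α) (a : α) :
    (K * L).leftQuotient [a] =
      K.leftQuotient [a] * L + ⨆ _ : [] ∈ K, L.leftQuotient [a] := by
  ext w
  simp only [mem_leftQuotient, mem_add, mem_iSup, mem_mul, List.singleton_append]
  constructor
  · rintro ⟨_ | ⟨b, u⟩, hu, v, hv, h⟩
    · exact .inr ⟨hu, by rwa [← h]⟩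
    · obtain ⟨rfl, rfl⟩ := List.cons_eq_cons.1 h
      exact .inl ⟨u, hu, v, hv, rfl⟩
  · rintro (⟨u, hu, v, hv, rfl⟩ | ⟨hK, hw⟩)
    exacts [⟨a :: u, hu, v, hv, rfl⟩, ⟨[], hK, a :: w, hw, rfl⟩]

theorem leftQuotient_kstar_singleton (L : Language α) (a : α) :
    L∗.leftQuotient [a] = L.leftQuotient [a] * L∗ := by
  ext w
  simp only [mem_leftQuotient, mem_mul, List.singleton_append]
  constructor
  · intro hw
    obtain ⟨_ | ⟨_ | ⟨b, u⟩, S⟩, h, hS⟩ := mem_kstar_iff_exists_nonempty.1 hw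
    · simp at h
    · exact absurd rfl (hS [] List.mem_cons_self).2
    · obtain ⟨rfl, rfl⟩ := List.cons_eq_cons.1 h
      exact ⟨u, (hS _ List.mem_cons_self).1, S.flatten,
        join_mem_kstar fun y hy => (hS y (List.mem_cons_of_mem _ hy)).1, rfl⟩
  · rintro ⟨u, hu, v, hv, rfl⟩
    rw [← one_add_self_mul_kstar_eq_kstar]
    exact .inr ⟨a :: u, hu, v, hv, rfl⟩

theorem leftQuotient_add (K L : Language α) (x : List α) :
    (K + L).leftQuotient x = K.leftQuotient x + L.leftQuotient x := rfl

theorem leftQuotient_sSup (U : Set (Language α)) (x : List α) :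
    (sSup U).leftQuotient x = sSup ((·.leftQuotient x) '' U) := by
  ext w
  simp only [mem_leftQuotient, sSup_eq_iSup, mem_iSup, Set.mem_image, exists_prop,
    exists_exists_and_eq_and]

theorem add_iSup_prop_eq_sSup (U : Set (Language α)) (p : Prop) (L : Language α) :
    sSup U + ⨆ _ : p, L = sSup (U ∪ {K | p ∧ K = L}) := by
  ext w
  simp only [mem_add, sSup_eq_iSup, mem_iSup, exists_prop, Set.mem_union, Set.mem_ofPred_eq]
  aesop

theorem isRegular_mul (hK : K.IsRegular) (hL : L.IsRegular) : (K * L).IsRegular := by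
  have hfin := (hK.finite_range_leftQuotient.prod hL.finite_range_leftQuotient.finite_subsets).image
    fun p => p.1 * L + sSup p.2
  refine isRegular_of_finite_closed hfin ⟨(K, ∅), ⟨⟨[], rfl⟩, Set.empty_subset _⟩, ?_⟩ ?_
  · simp only [sSup_empty]
    exact sup_bot_eq _
  · rintro _ ⟨⟨_, U⟩, ⟨⟨x, rfl⟩, hU⟩, rfl⟩ a
    refine ⟨(K.leftQuotient (x ++ [a]), (·.leftQuotient [a]) '' U ∪
      {K' | [] ∈ K.leftQuotient x ∧ K' = L.leftQuotient [a]}), ⟨⟨_, rfl⟩, ?_⟩, ?_⟩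
    · rintro _ (⟨_, hU', rfl⟩ | ⟨-, rfl⟩)
      · obtain ⟨y, rfl⟩ := hU hU'
        exact ⟨y ++ [a], leftQuotient_append ..⟩
      · exact ⟨_, rfl⟩
    · simp only [leftQuotient_add, leftQuotient_mul_singleton, leftQuotient_append,
        leftQuotient_sSup, ← add_iSup_prop_eq_sSup]
      ac_rfl

theorem isRegular_kstar (hL : L.IsRegular) : L∗.IsRegular := by
  have hfin := (hL.finite_range_leftQuotient.finite_subsets.image fun U => sSup U * L∗).insert L∗
  refine isRegular_of_finite_closed hfin (Set.mem_insert ..) ?_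
  rintro _ (rfl | ⟨U, hU, rfl⟩) a
  · refine .inr ⟨{L.leftQuotient [a]}, by simp, ?_⟩
    simp only [sSup_singleton, leftQuotient_kstar_singleton]
  · refine .inr ⟨(·.leftQuotient [a]) '' U ∪ {K | [] ∈ sSup U ∧ K = L.leftQuotient [a]}, ?_, ?_⟩
    · rintro _ (⟨_, hU', rfl⟩ | ⟨-, rfl⟩)
      · obtain ⟨y, rfl⟩ := hU hU'
        exact ⟨y ++ [a], leftQuotient_append ..⟩
      · exact ⟨_, rfl⟩
    · simp only [leftQuotient_mul_singleton, leftQuotient_kstar_singleton, leftQuotient_sSup,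
        ← add_iSup_prop_eq_sSup, add_mul, iSup_mul]

theorem isRegular_bot : (⊥ : Language α).IsRegular :=
  isRegular_of_finite_closed (Set.finite_singleton ⊥) rfl (by rintro _ rfl a; rfl)

theorem isRegular_singleton (w : List α) : ({w} : Language α).IsRegular := by
  have hfin : ({v | v <:+ w}.image fun v => ({v} : Language α)).Finite :=
    (w.tails.finite_toSet.subset fun v hv => by simpa using hv).image _
  refine isRegular_of_finite_closed (hfin.insert ⊥) (.inr ⟨w, List.suffix_rfl, rfl⟩) ?_
  rintro _ (rfl | ⟨v, hv, rfl⟩) a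
  · exact .inl rfl
  · rcases v with _ | ⟨b, v⟩
    · exact .inl (Set.eq_empty_of_forall_notMem fun x hx => List.cons_ne_nil a x hx)
    · by_cases hab : a = b
      · refine .inr ⟨v, (List.suffix_cons b v).trans hv, ?_⟩
        ext x
        change x = v ↔ a :: x = b :: v
        simp [hab]
      · exact .inl (Set.eq_empty_of_forall_notMem fun x hx => hab (List.cons_eq_cons.1 hx).1)

theorem isRegular_prefixes (hL : L.IsRegular) :
    Language.IsRegular {x | ∃ w ∈ L, x <+: w} := by
  obtain ⟨σ, _, M, rfl⟩ := hL
  refine ⟨σ, inferInstance, { M with accept := {q | ∃ y, M.evalFrom q y ∈ M.accept} }, ?_⟩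
  ext x
  constructor
  · rintro ⟨y, hy⟩
    exact ⟨x ++ y, by rwa [DFA.mem_accepts, DFA.eval, DFA.evalFrom_of_append], y, rfl⟩
  · rintro ⟨_, hw, y, rfl⟩
    exact ⟨y, by rwa [DFA.mem_accepts, DFA.eval, DFA.evalFrom_of_append] at hw⟩

theorem isRegular_comap (f : α → β) {L : Language β} (hL : L.IsRegular) :
    Language.IsRegular {w : List α | w.map f ∈ L} := by
  obtain ⟨σ, _, M, rfl⟩ := hL
  exact ⟨σ, inferInstance, M.comap f, M.accepts_comap f⟩

theorem isRegular_exists_mem (p : α → Prop) :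
    Language.IsRegular {w : List α | ∃ a ∈ w, p a} := by
  refine isRegular_of_finite_closed (T := {{w | ∃ a ∈ w, p a}, ⊤})
    ((Set.finite_singleton _).insert _) (.inl rfl) ?_
  rintro _ (rfl | rfl) a
  · by_cases ha : p a
    · exact .inr (Set.eq_univ_of_forall fun w => ⟨a, by simp, ha⟩)
    · refine .inl (Set.ext fun w => ?_)
      change (∃ b ∈ a :: w, p b) ↔ ∃ b ∈ w, p b
      simp [ha]
  · exact .inr rfl

theorem isRegular_exists_finset {ι : Type*} (R : Finset ι) {L : ι → Language α}
    (h : ∀ r ∈ R, (L r).IsRegular) : Language.IsRegular {w | ∃ r ∈ R, w ∈ L r} := by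
  suffices {w | ∃ r ∈ R, w ∈ L r} = R.sup L from
    this ▸ Finset.sup_induction isRegular_bot (fun _ hK _ hL => hK.add hL) h
  refine Language.ext fun w => ?_
  simp only [Finset.sup_eq_iSup, Language.mem_iSup, exists_prop]
  rfl

theorem exists_finset_forall_mem_matches' (P : RegularExpression α) :
    ∃ Λ : Finset α, ∀ w ∈ P.matches', ∀ a ∈ w, a ∈ Λ := by
  classical
  induction P with
  | zero => exact ⟨∅, fun w hw => hw.elim⟩
  | epsilon => exact ⟨∅, by rintro _ rfl a ha; simp at ha⟩
  | char a => exact ⟨{a}, by rintro _ rfl b hb; simpa using hb⟩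
  | plus P Q hP hQ =>
    obtain ⟨Λ, hΛ⟩ := hP
    obtain ⟨Λ', hΛ'⟩ := hQ
    refine ⟨Λ ∪ Λ', ?_⟩
    rintro w (hw | hw) a ha
    exacts [Finset.mem_union_left _ (hΛ w hw a ha), Finset.mem_union_right _ (hΛ' w hw a ha)]
  | comp P Q hP hQ =>
    obtain ⟨Λ, hΛ⟩ := hP
    obtain ⟨Λ', hΛ'⟩ := hQ
    refine ⟨Λ ∪ Λ', ?_⟩
    rintro _ ⟨u, hu, v, hv, rfl⟩ a ha
    exact Finset.mem_union.2 ((List.mem_append.1 ha).imp (hΛ u hu a) (hΛ' v hv a))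
  | star P hP =>
    obtain ⟨Λ, hΛ⟩ := hP
    refine ⟨Λ, ?_⟩
    rintro _ ⟨S, rfl, hS⟩ a ha
    obtain ⟨w, hw, ha⟩ := List.mem_flatten.1 ha
    exact hΛ w (hS w hw) a ha

/-- The image of a language under the substitution of words for letters. -/
def substWords (f : α → List β) (L : Language α) : Language β := {x | ∃ w ∈ L, w.flatMap f = x}

theorem substWords_mul (f : α → List β) (K L : Language α) :
    substWords f (K * L) = substWords f K * substWords f L := by
  ext x
  constructor
  · rintro ⟨_, ⟨u, hu, v, hv, rfl⟩, rfl⟩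
    exact ⟨_, ⟨u, hu, rfl⟩, _, ⟨v, hv, rfl⟩, List.flatMap_append.symm⟩
  · rintro ⟨_, ⟨u, hu, rfl⟩, _, ⟨v, hv, rfl⟩, rfl⟩
    exact ⟨_, ⟨u, hu, v, hv, rfl⟩, List.flatMap_append⟩

theorem substWords_singleton (f : α → List β) (w : List α) :
    substWords f {w} = {w.flatMap f} := by
  ext x
  constructor
  · rintro ⟨_, rfl, rfl⟩; rfl
  · rintro rfl; exact ⟨w, rfl, rfl⟩

theorem substWords_pow (f : α → List β) (L : Language α) (n : ℕ) :
    substWords f (L ^ n) = substWords f L ^ n := by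
  induction n with
  | zero => exact substWords_singleton f []
  | succ n ih => rw [pow_succ, pow_succ, substWords_mul, ih]

theorem substWords_kstar (f : α → List β) (L : Language α) :
    substWords f L∗ = (substWords f L)∗ := by
  rw [kstar_eq_iSup_pow, kstar_eq_iSup_pow]
  ext x
  simp only [← substWords_pow, mem_iSup]
  constructor
  · rintro ⟨w, hw, rfl⟩
    obtain ⟨n, hw⟩ := mem_iSup.1 hw
    exact ⟨n, w, hw, rfl⟩
  · rintro ⟨n, w, hw, rfl⟩
    exact ⟨w, mem_iSup.2 ⟨n, hw⟩, rfl⟩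

theorem isRegular_substWords_matches' (f : α → List β) (P : RegularExpression α) :
    (substWords f P.matches').IsRegular := by
  induction P with
  | zero =>
    convert isRegular_bot (α := β)
    exact Set.eq_empty_of_forall_notMem fun x ⟨_, hw, _⟩ => hw
  | epsilon => exact substWords_singleton f [] ▸ isRegular_singleton _
  | char a => exact substWords_singleton f [a] ▸ isRegular_singleton _
  | plus P Q hP hQ =>
    convert hP.add hQ
    ext x
    constructor
    · rintro ⟨w, hw | hw, h⟩
      exacts [.inl ⟨w, hw, h⟩, .inr ⟨w, hw, h⟩]
    · rintro (⟨w, hw, h⟩ | ⟨w, hw, h⟩)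
      exacts [⟨w, .inl hw, h⟩, ⟨w, .inr hw, h⟩]
  | comp P Q hP hQ => exact substWords_mul f _ _ ▸ isRegular_mul hP hQ
  | star P hP => exact substWords_kstar f _ ▸ isRegular_kstar hP

end RegularLanguages

theorem notMem_acceptsFrom_empty {α σ : Type*} (M : NFA α σ) (w : List α) :
    w ∉ M.acceptsFrom ∅ := by
  rintro ⟨q, -, hq⟩
  simpa using M.mem_evalFrom_iff_exists.1 hq

namespace FinAutomaton

variable {A : Type}

theorem exists_language_eq {L : Language A} (hL : L.IsRegular) (Λ : Finset A) :
    ∃ 𝒜 : FinAutomaton A, 𝒜.language = {w | w ∈ L ∧ ∀ a ∈ w, a ∈ Λ} := by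
  classical
  obtain ⟨σ, _, M, rfl⟩ := hL
  obtain ⟨n, ⟨e⟩⟩ := Finite.exists_equiv_fin σ
  let ι : σ → ℕ := fun q => e q
  have hι : Function.Injective ι := Fin.val_injective.comp e.injective
  let 𝒜 : FinAutomaton A := ([ι M.start],
    (Finset.univ ×ˢ Λ).toList.map fun t => (ι t.1, t.2, ι (M.step t.1 t.2)),
    (Finset.univ.filter (· ∈ M.accept)).toList.map ι)
  have hstep (q : σ) (a : A) : 𝒜.toNFA.step (ι q) a = {r | a ∈ Λ ∧ ι (M.step q a) = r} := by
    ext r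
    simp [toNFA, 𝒜, hι.eq_iff]
  have haccept (q : σ) : ι q ∈ 𝒜.toNFA.accept ↔ q ∈ M.accept := by
    simp [toNFA, 𝒜, hι.eq_iff]
  have hfrom (w : List A) (q : σ) :
      w ∈ 𝒜.toNFA.acceptsFrom {ι q} ↔ w ∈ M.acceptsFrom q ∧ ∀ a ∈ w, a ∈ Λ := by
    induction w generalizing q with
    | nil => simp [haccept, DFA.mem_acceptsFrom]
    | cons a w ih =>
      have hcons : a :: w ∈ M.acceptsFrom q ↔ w ∈ M.acceptsFrom (M.step q a) := Iff.rfl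
      rw [NFA.cons_mem_acceptsFrom, NFA.stepSet_singleton, hstep, hcons, List.forall_mem_cons]
      by_cases ha : a ∈ Λ
      · simpa [ha] using ih (M.step q a)
      · simp [ha, notMem_acceptsFrom_empty]
  refine ⟨𝒜, Set.ext fun w => ?_⟩
  have hstart : 𝒜.toNFA.start = {ι M.start} := by simp [toNFA, 𝒜]
  rw [language, NFA.accepts_eq_acceptsFrom_start, hstart]
  exact hfrom w M.start

/-- The automaton that reads the letter `a` and then runs `𝒜`, and that also accepts the empty
word. The states of `𝒜` are shifted to make room for the new initial state `0`. -/
def prepend (a : A) (𝒜 : FinAutomaton A) : FinAutomaton A :=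
  ([0], 𝒜.1.map (fun q => (0, a, q + 1)) ++ 𝒜.2.1.map (fun t => (t.1 + 1, t.2.1, t.2.2 + 1)),
    0 :: 𝒜.2.2.map (· + 1))

theorem acceptsFrom_prepend (a : A) (𝒜 : FinAutomaton A) (S : Set ℕ) :
    (𝒜.prepend a).toNFA.acceptsFrom ((· + 1) '' S) = 𝒜.toNFA.acceptsFrom S := by
  ext w
  induction w generalizing S with
  | nil => simp [toNFA, prepend]
  | cons b w ih =>
    have hstep : (𝒜.prepend a).toNFA.stepSet ((· + 1) '' S) b =
        (· + 1) '' 𝒜.toNFA.stepSet S b := by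
      ext r
      simp only [toNFA, prepend, NFA.mem_stepSet, Set.mem_image, Set.mem_ofPred_eq]
      aesop
    rw [NFA.cons_mem_acceptsFrom, NFA.cons_mem_acceptsFrom, hstep, ih]

theorem cons_mem_language_prepend {a b : A} {𝒜 : FinAutomaton A} {w : List A} :
    b :: w ∈ (𝒜.prepend a).language ↔ b = a ∧ w ∈ 𝒜.language := by
  have hstep : (𝒜.prepend a).toNFA.stepSet {0} b =
      (· + 1) '' {q | b = a ∧ q ∈ 𝒜.toNFA.start} := by
    ext r
    simp only [toNFA, prepend, NFA.stepSet_singleton]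
    aesop
  have hstart : (𝒜.prepend a).toNFA.start = {0} := by simp [toNFA, prepend]
  rw [language, NFA.accepts_eq_acceptsFrom_start, hstart, NFA.cons_mem_acceptsFrom, hstep,
    acceptsFrom_prepend]
  by_cases hb : b = a
  · simp only [hb, true_and, Set.ofPred_mem_eq]; rfl
  · simp [hb, notMem_acceptsFrom_empty]

theorem nil_mem_language_prepend {a : A} {𝒜 : FinAutomaton A} :
    [] ∈ (𝒜.prepend a).language :=
  (NFA.nil_mem_acceptsFrom _).2 ⟨0, by simp [toNFA, prepend]⟩

theorem mem_language_prepend_iterate {a : A} {𝒜 : FinAutomaton A} {L : Language A}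
    (h𝒜 : 𝒜.language = {x | ∃ w ∈ L, x <+: w}) (hL : ∃ w, w ∈ L) {n : ℕ} {x : List A} :
    x ∈ ((prepend a)^[n] 𝒜).language ↔ ∃ w ∈ L, x <+: List.replicate n a ++ w := by
  induction n generalizing x with
  | zero => exact Set.ext_iff.1 h𝒜 x
  | succ n ih =>
    rw [Function.iterate_succ_apply']
    rcases x with _ | ⟨b, x⟩
    · exact iff_of_true nil_mem_language_prepend (hL.imp fun w hw => ⟨hw, List.nil_prefix⟩)
    · simp only [cons_mem_language_prepend, ih, List.replicate_succ, List.cons_append,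
        List.cons_prefix_cons, and_left_comm, exists_and_left]

theorem primrec_prepend [Primcodable A] (a : A) : Primrec (prepend a) := by
  have hstart : Primrec fun 𝒜 : FinAutomaton A => 𝒜.1.map fun q => (0, a, q + 1) :=
    Primrec.list_map Primrec.fst
      ((Primrec.const 0).pair ((Primrec.const a).pair (Primrec.succ.comp Primrec.snd)))
  have hshift : Primrec fun 𝒜 : FinAutomaton A =>
      𝒜.2.1.map fun t => (t.1 + 1, t.2.1, t.2.2 + 1) :=
    Primrec.list_map (Primrec.fst.comp Primrec.snd)
      ((Primrec.succ.comp (Primrec.fst.comp Primrec.snd)).pair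
        ((Primrec.fst.comp (Primrec.snd.comp Primrec.snd)).pair
          (Primrec.succ.comp (Primrec.snd.comp (Primrec.snd.comp Primrec.snd)))))
  have haccept : Primrec fun 𝒜 : FinAutomaton A => 𝒜.2.2.map (· + 1) :=
    Primrec.list_map (Primrec.snd.comp Primrec.snd) (Primrec.succ.comp Primrec.snd)
  exact ((Primrec.const [0]).pair ((Primrec.list_append.comp hstart hshift).pair
    (Primrec.list_cons.comp (Primrec.const 0) haccept)))

theorem computable_prepend_iterate [Primcodable A] (a : A) (𝒜 : FinAutomaton A) :
    Computable fun n => (prepend a)^[n] 𝒜 :=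
  (Primrec.nat_iterate .id (.const 𝒜) ((primrec_prepend a).comp .snd).to₂).to_comp

end FinAutomaton

/-! ## Counter programs -/

/-- Instructions on integer counters: increment, decrement, test for zero. -/
inductive Instr where
  | inc (r : ℕ)
  | dec (r : ℕ)
  | zero (r : ℕ)

/-- The input-output relation of an instruction on the contents of the counters. -/
def Instr.Rel : Instr → (ℕ → ℤ) → (ℕ → ℤ) → Prop
  | inc r, s, t => t = s + Pi.single r 1
  | dec r, s, t => t = s + Pi.single r (-1)
  | zero r, s, t => s r = 0 ∧ t = s

/-- The input-output relation of a sequence of instructions. -/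
def Run : List Instr → (ℕ → ℤ) → (ℕ → ℤ) → Prop
  | [], s, t => t = s
  | i :: w, s, t => ∃ u, i.Rel s u ∧ Run w u t

theorem run_append {w x : List Instr} {s t : ℕ → ℤ} :
    Run (w ++ x) s t ↔ ∃ u, Run w s u ∧ Run x u t := by
  induction w generalizing s with
  | nil => simp [Run]
  | cons i w ih =>
    simp only [List.cons_append, Run, ih]
    exact ⟨fun ⟨u, hu, v, hv, h⟩ => ⟨v, ⟨u, hu, hv⟩, h⟩,
      fun ⟨v, ⟨u, hu, hv⟩, h⟩ => ⟨u, hu, v, hv, h⟩⟩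

theorem run_replicate_inc {r n : ℕ} {s t : ℕ → ℤ} :
    Run (List.replicate n (.inc r)) s t ↔ t = s + Pi.single r (n : ℤ) := by
  induction n generalizing s with
  | zero => simp [Run]
  | succ n ih =>
    simp only [List.replicate_succ, Run, ih, Instr.Rel, exists_eq_left, add_assoc,
      ← Pi.single_add, Nat.cast_add, Nat.cast_one, add_comm (1 : ℤ)]

/-- The input-output relation of a nondeterministic counter program, given as a regular expression
over instructions. -/
def Reaches (P : RegularExpression Instr) (s t : ℕ → ℤ) : Prop := ∃ w ∈ P.matches', Run w s t

section Reaches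

open RegularExpression

variable {P Q : RegularExpression Instr} {s t : ℕ → ℤ}

theorem reaches_one : Reaches 1 s t ↔ t = s :=
  ⟨fun ⟨_, hw, h⟩ => by cases hw; exact h, fun h => ⟨[], rfl, h⟩⟩

theorem reaches_char {i : Instr} : Reaches (char i) s t ↔ i.Rel s t := by
  constructor
  · rintro ⟨_, rfl, u, hu, rfl⟩
    exact hu
  · exact fun h => ⟨[i], rfl, t, h, rfl⟩

theorem reaches_mul : Reaches (P * Q) s t ↔ ∃ u, Reaches P s u ∧ Reaches Q u t := by
  constructor
  · rintro ⟨_, ⟨w, hw, x, hx, rfl⟩, h⟩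
    obtain ⟨u, hu, hut⟩ := run_append.1 h
    exact ⟨u, ⟨w, hw, hu⟩, x, hx, hut⟩
  · rintro ⟨u, ⟨w, hw, hu⟩, x, hx, hut⟩
    exact ⟨w ++ x, ⟨w, hw, x, hx, rfl⟩, run_append.2 ⟨u, hu, hut⟩⟩

theorem reaches_star : Reaches P.star s t ↔ Relation.ReflTransGen (Reaches P) s t := by
  constructor
  · rintro ⟨_, ⟨S, rfl, hS⟩, h⟩
    induction S generalizing s with
    | nil => exact h ▸ .refl
    | cons w S ih =>
      obtain ⟨hw, hS⟩ := List.forall_mem_cons.1 hS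
      obtain ⟨u, hu, hut⟩ := run_append.1 h
      exact .head ⟨w, hw, hu⟩ (ih hS hut)
  · intro h
    induction h using Relation.ReflTransGen.head_induction_on with
    | refl => exact ⟨[], Language.nil_mem_kstar _, rfl⟩
    | head hu _ ih =>
      obtain ⟨w, hw, hu⟩ := hu
      obtain ⟨_, ⟨S, rfl, hS⟩, hut⟩ := ih
      exact ⟨w ++ S.flatten, ⟨w :: S, rfl, List.forall_mem_cons.2 ⟨hw, hS⟩⟩,
        run_append.2 ⟨_, hu, hut⟩⟩

/-- The program `P` adds the vector `δ` to the counters. -/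
def IsShift (P : RegularExpression Instr) (δ : ℕ → ℤ) : Prop :=
  ∀ s t, Reaches P s t ↔ t = s + δ

theorem isShift_inc (r : ℕ) : IsShift (char (.inc r)) (Pi.single r 1) := fun _ _ => reaches_char

theorem isShift_dec (r : ℕ) : IsShift (char (.dec r)) (Pi.single r (-1)) := fun _ _ => reaches_char

theorem IsShift.mul {δ ε : ℕ → ℤ} (hP : IsShift P δ) (hQ : IsShift Q ε) :
    IsShift (P * Q) (δ + ε) := fun s t => by
  simp only [reaches_mul, hP s _, hQ _ t, exists_eq_left, add_assoc]

theorem IsShift.reaches_star {δ : ℕ → ℤ} (hP : IsShift P δ) :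
    Reaches P.star s t ↔ ∃ n : ℕ, t = s + n • δ := by
  rw [_root_.reaches_star]
  constructor
  · intro h
    induction h with
    | refl => exact ⟨0, by simp⟩
    | tail _ hu ih =>
      obtain ⟨n, rfl⟩ := ih
      exact ⟨n + 1, by rw [(hP _ _).1 hu, succ_nsmul, add_assoc]⟩
  · rintro ⟨n, rfl⟩
    induction n with
    | zero => simpa using .refl
    | succ n ih => exact ih.tail ((hP _ _).2 (by rw [succ_nsmul, add_assoc]))

/-- The program that repeats `P` until the counter `i` is zero. -/
def drain (P : RegularExpression Instr) (i : ℕ) : RegularExpression Instr :=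
  P.star * char (.zero i)

theorem IsShift.reaches_drain {δ : ℕ → ℤ} {i n : ℕ} (hP : IsShift P δ) (hδ : δ i = -1)
    (hs : s i = n) : Reaches (drain P i) s t ↔ t = s + n • δ := by
  simp only [drain, reaches_mul, hP.reaches_star, reaches_char, Instr.Rel]
  constructor
  · rintro ⟨_, ⟨m, rfl⟩, hm, rfl⟩
    have hmn : m = n := by
      simp only [Pi.add_apply, Pi.smul_apply, hs, hδ, smul_neg, nsmul_one] at hm
      lia
    rw [hmn]
  · rintro rfl
    exact ⟨_, ⟨n, rfl⟩, by simp [hs, hδ], rfl⟩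

end Reaches

section HasOutcomes

open RegularExpression Function

variable {P Q : RegularExpression Instr} {s : ℕ → ℕ} {A : Set (ℕ → ℕ)}

/-- The runs of `P` from the natural numbers `s` can end exactly in the states of `A`, which consist
of natural numbers. -/
def HasOutcomes (P : RegularExpression Instr) (s : ℕ → ℕ) (A : Set (ℕ → ℕ)) : Prop :=
  ∀ t, Reaches P (fun r => s r) t ↔ ∃ u ∈ A, t = fun r => (u r : ℤ)

theorem hasOutcomes_one (s : ℕ → ℕ) : HasOutcomes 1 s {s} := fun t => by
  simp [reaches_one]

theorem HasOutcomes.mul {B : (ℕ → ℕ) → Set (ℕ → ℕ)} (hP : HasOutcomes P s A)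
    (hQ : ∀ u ∈ A, HasOutcomes Q u (B u)) : HasOutcomes (P * Q) s (⋃ u ∈ A, B u) := fun t => by
  rw [reaches_mul]
  constructor
  · rintro ⟨_, hu, ht⟩
    obtain ⟨u, huA, rfl⟩ := (hP _).1 hu
    obtain ⟨v, hv, rfl⟩ := (hQ u huA _).1 ht
    exact ⟨v, Set.mem_biUnion huA hv, rfl⟩
  · rintro ⟨v, hv, rfl⟩
    obtain ⟨u, hu, hv⟩ := Set.mem_iUnion₂.1 hv
    exact ⟨_, (hP _).2 ⟨u, hu, rfl⟩, (hQ u hu _).2 ⟨v, hv, rfl⟩⟩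

theorem HasOutcomes.mul_unique {u : ℕ → ℕ} (hP : HasOutcomes P s {u}) (hQ : HasOutcomes Q u A) :
    HasOutcomes (P * Q) s A := by
  simpa using hP.mul (B := fun _ => A) (by simpa using hQ)

theorem HasOutcomes.star {C : (ℕ → ℕ) → Set (ℕ → ℕ)} {B : ℕ → Set (ℕ → ℕ)}
    (hP : ∀ m, ∀ u ∈ B m, HasOutcomes P u (C u)) (hzero : B 0 = {s})
    (hsucc : ∀ m, B (m + 1) = ⋃ u ∈ B m, C u) : HasOutcomes P.star s (⋃ m, B m) := fun t => by
  rw [reaches_star]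
  constructor
  · intro h
    induction h with
    | refl => exact ⟨s, Set.mem_iUnion.2 ⟨0, by simp [hzero]⟩, rfl⟩
    | tail _ ht ih =>
      obtain ⟨u, hu, rfl⟩ := ih
      obtain ⟨m, hu⟩ := Set.mem_iUnion.1 hu
      obtain ⟨v, hv, rfl⟩ := (hP m u hu _).1 ht
      exact ⟨v, Set.mem_iUnion.2 ⟨m + 1, hsucc m ▸ Set.mem_biUnion hu hv⟩, rfl⟩
  · rintro ⟨v, hv, rfl⟩
    obtain ⟨m, hm⟩ := Set.mem_iUnion.1 hv
    clear hv
    induction m generalizing v with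
    | zero =>
      obtain rfl : v = s := by simpa [hzero] using hm
      exact .refl
    | succ m ih =>
      rw [hsucc] at hm
      obtain ⟨u, hu, hv⟩ := Set.mem_iUnion₂.1 hm
      exact (ih u hu).tail ((hP m u hu _).2 ⟨v, hv, rfl⟩)

theorem hasOutcomes_zero (s : ℕ → ℕ) (r : ℕ) :
    HasOutcomes (char (.zero r)) s {v | v = s ∧ s r = 0} := fun t => by
  simp [reaches_char, Instr.Rel, and_comm]

theorem hasOutcomes_inc (s : ℕ → ℕ) (r : ℕ) :
    HasOutcomes (char (.inc r)) s {update s r (s r + 1)} := fun t => by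
  have : (fun i => (s i : ℤ)) + Pi.single r 1 = fun i => (update s r (s r + 1) i : ℤ) := by
    ext i
    rcases eq_or_ne i r with rfl | hi <;> simp [*]
  simp [reaches_char, Instr.Rel, this]

theorem hasOutcomes_dec (s : ℕ → ℕ) (r : ℕ) :
    HasOutcomes (char (.dec r)) (update s r (s r + 1)) {s} := fun t => by
  have : (fun i => (update s r (s r + 1) i : ℤ)) + Pi.single r (-1) = fun i => (s i : ℤ) := by
    ext i
    rcases eq_or_ne i r with rfl | hi <;> simp [*]
  simp [reaches_char, Instr.Rel, this]

theorem hasOutcomes_guess {r : ℕ} (hr : s r = 0) :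
    HasOutcomes (char (.inc r)).star s (Set.range (update s r)) := fun t => by
  have (n : ℕ) : (fun i => (s i : ℤ)) + n • Pi.single r (1 : ℤ) =
      fun i => (update s r n i : ℤ) := by
    ext i
    rcases eq_or_ne i r with rfl | hi <;> simp [*]
  simp only [(isShift_inc r).reaches_star, this, Set.exists_range_iff]

theorem IsShift.hasOutcomes_drain {δ : ℕ → ℤ} {i : ℕ} {u : ℕ → ℕ} (hP : IsShift P δ)
    (hδ : δ i = -1) (hu : ∀ r, (u r : ℤ) = s r + s i * δ r) :
    HasOutcomes (drain P i) s {u} := fun t => by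
  have : (fun r => (u r : ℤ)) = (fun r => (s r : ℤ)) + s i • δ := by
    ext r
    simp [hu]
  rw [hP.reaches_drain (n := s i) hδ rfl, ← this]
  simp

theorem hasOutcomes_clear (s : ℕ → ℕ) (r : ℕ) :
    HasOutcomes (drain (char (.dec r)) r) s {update s r 0} := by
  refine (isShift_dec r).hasOutcomes_drain (by simp) fun i => ?_
  rcases eq_or_ne i r with rfl | hi <;> simp [*]

theorem hasOutcomes_move {i j : ℕ} (hij : i ≠ j) (hj : s j = 0) :
    HasOutcomes (drain (char (.dec i) * char (.inc j)) i) s {update (update s j (s i)) i 0} := by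
  refine ((isShift_dec i).mul (isShift_inc j)).hasOutcomes_drain (by simp [hij]) fun r => ?_
  rcases eq_or_ne r i with rfl | hi
  · simp [hij]
  · rcases eq_or_ne r j with rfl | hj' <;> simp [*]

/-- The program that tests whether the counters `i` and `j` are equal: it moves their common value
to the counter `b` and back. -/
def testEq (i j b : ℕ) : RegularExpression Instr :=
  drain (char (.dec i) * char (.dec j) * char (.inc b)) i * char (.zero j) *
    drain (char (.inc i) * char (.inc j) * char (.dec b)) b

theorem hasOutcomes_testEq {i j b : ℕ} (hij : i ≠ j) (hi : i ≠ b) (hj : j ≠ b) (hb : s b = 0) :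
    HasOutcomes (testEq i j b) s {v | v = s ∧ s i = s j} := fun t => by
  have hdown := ((isShift_dec i).mul (isShift_dec j)).mul (isShift_inc b)
  have hup := ((isShift_inc i).mul (isShift_inc j)).mul (isShift_dec b)
  set δ : ℕ → ℤ := Pi.single i (-1) + Pi.single j (-1) + Pi.single b 1 with hδ
  have hneg : Pi.single i 1 + Pi.single j 1 + Pi.single b (-1) = -δ := by
    simp only [hδ, Pi.single_neg]
    abel
  have hdrain (t) := hdown.reaches_drain (s := fun r => (s r : ℤ)) (t := t) (i := i)
    (by simp [hδ, hij, hi]) rfl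
  have hrefill (t) := (hneg ▸ hup).reaches_drain (s := (fun r => (s r : ℤ)) + s i • δ)
    (t := t) (i := b) (n := s i) (by simp [hδ, hi.symm, hj.symm])
    (by simp [hδ, hb, hi.symm, hj.symm])
  have hzero : ((fun r => (s r : ℤ)) + s i • δ) j = 0 ↔ s i = s j := by
    simp only [hδ, Pi.add_apply, Pi.smul_apply, Pi.single_eq_same, Pi.single_eq_of_ne hij.symm,
      Pi.single_eq_of_ne hj]
    lia
  simp only [smul_neg, add_neg_cancel_right] at hrefill
  simp only [testEq, reaches_mul, hdrain, reaches_char, Instr.Rel, hzero, exists_eq_left,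
    and_comm (a := s i = s j), and_assoc, hrefill, Set.mem_ofPred_eq]

end HasOutcomes

/-! ## Partial recursive functions -/

section IsTest

open RegularExpression Function

/-- The counters with index at least `b` are zero. -/
def SupportedBelow (b : ℕ) (s : ℕ → ℕ) : Prop := ∀ r, b ≤ r → s r = 0

theorem SupportedBelow.mono {b c : ℕ} {s : ℕ → ℕ} (hs : SupportedBelow b s) (hbc : b ≤ c) :
    SupportedBelow c s := fun r hr => hs r (hbc.trans hr)

theorem SupportedBelow.update {b r : ℕ} {s : ℕ → ℕ} (hs : SupportedBelow b s) (hr : r < b) (y : ℕ) :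
    SupportedBelow b (update s r y) := fun i hi => by
  rw [update_of_ne (hr.trans_le hi).ne', hs i hi]

/-- The predicate `ρ` on states can be tested by a program. The program uses counters with index at
least `b` as scratch space; it has a run if and only if `ρ` holds, and its runs restore the
state. -/
def IsTest (b : ℕ) (ρ : (ℕ → ℕ) → Prop) : Prop :=
  ∃ P, ∀ s, SupportedBelow b s → HasOutcomes P s {v | v = s ∧ ρ s}

variable {b : ℕ} {ρ σ : (ℕ → ℕ) → Prop}

theorem IsTest.congr (hρ : IsTest b ρ) (h : ∀ s, SupportedBelow b s → (ρ s ↔ σ s)) :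
    IsTest b σ := by
  obtain ⟨P, hP⟩ := hρ
  exact ⟨P, fun s hs => by simpa only [h s hs] using hP s hs⟩

theorem isTest_true : IsTest b fun _ => True :=
  ⟨1, fun s _ => by simpa using hasOutcomes_one s⟩

theorem isTest_false : IsTest b fun _ => False :=
  ⟨0, fun s _ t => by simp [Reaches]⟩

theorem HasOutcomes.mul_test {P Q : RegularExpression Instr} {s u : ℕ → ℕ} {p : Prop}
    {A : Set (ℕ → ℕ)} (hP : HasOutcomes P s {v | v = u ∧ p}) (hQ : HasOutcomes Q u A) :
    HasOutcomes (P * Q) s {v | p ∧ v ∈ A} := by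
  convert hP.mul (B := fun _ => A) (by rintro _ ⟨rfl, -⟩; exact hQ) using 1
  ext v
  simp

theorem IsTest.and (hρ : IsTest b ρ) (hσ : IsTest b σ) : IsTest b fun s => ρ s ∧ σ s := by
  obtain ⟨P, hP⟩ := hρ
  obtain ⟨Q, hQ⟩ := hσ
  refine ⟨P * Q, fun s hs => ?_⟩
  convert (hP s hs).mul_test (hQ s hs) using 1
  ext v
  simp [and_left_comm]

theorem IsTest.exists (hρ : IsTest (b + 1) ρ) : IsTest b fun s => ∃ y, ρ (update s b y) := by
  obtain ⟨P, hP⟩ := hρ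
  refine ⟨(char (.inc b)).star * (P * drain (char (.dec b)) b), fun s hs => ?_⟩
  have hsb := hs b le_rfl
  convert (hasOutcomes_guess hsb).mul (B := fun u => {v | ρ u ∧ v ∈ ({update u b 0} : Set _)}) ?_
    using 1
  · ext v
    simp [← hsb, exists_and_right, and_comm]
  · rintro _ ⟨y, rfl⟩
    exact (hP _ ((hs.mono b.le_succ).update b.lt_succ_self y)).mul_test (hasOutcomes_clear _ b)

theorem IsTest.exists_block {n : ℕ} (hρ : IsTest (b + n) ρ) :
    IsTest b fun s => ∃ u : ℕ → ℕ, (∀ r, r < b ∨ b + n ≤ r → u r = s r) ∧ ρ u := by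
  induction n generalizing ρ with
  | zero =>
    refine hρ.congr fun s _ => ⟨fun h => ⟨s, fun _ _ => rfl, h⟩, ?_⟩
    rintro ⟨u, hu, h⟩
    rwa [← funext fun r => hu r (lt_or_ge r b)]
  | succ n ih =>
    refine (ih hρ.exists).congr fun s _ => ⟨?_, ?_⟩
    · rintro ⟨u, hu, y, h⟩
      refine ⟨_, fun r hr => ?_, h⟩
      rw [update_of_ne (by lia), hu r (by lia)]
    · rintro ⟨u, hu, h⟩
      refine ⟨update u (b + n) (s (b + n)), fun r hr => ?_, u (b + n), by simpa using h⟩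
      rcases eq_or_ne r (b + n) with rfl | hne
      · simp
      · rw [update_of_ne hne, hu r (by lia)]

theorem isTest_forall_fin {n : ℕ} {ρ : Fin n → (ℕ → ℕ) → Prop} (h : ∀ i, IsTest b (ρ i)) :
    IsTest b fun s => ∀ i, ρ i s := by
  induction n with
  | zero => exact isTest_true.congr (by simp)
  | succ n ih =>
    exact ((h 0).and (ih fun i => h i.succ)).congr fun s _ =>
      (Fin.forall_fin_succ (P := fun i => ρ i s)).symm

theorem isTest_eq_zero (i : ℕ) : IsTest b fun s => s i = 0 :=
  ⟨char (.zero i), fun s _ => hasOutcomes_zero s i⟩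

theorem isTest_eq {i j : ℕ} (hi : i < b) (hj : j < b) : IsTest b fun s => s i = s j := by
  rcases eq_or_ne i j with rfl | hij
  · exact isTest_true.congr (by simp)
  · exact ⟨testEq i j b, fun s hs => hasOutcomes_testEq hij hi.ne hj.ne (hs b le_rfl)⟩

theorem isTest_eq_add_one {i j : ℕ} (hi : i < b) (hj : j < b) :
    IsTest b fun s => s i = s j + 1 := by
  rcases eq_or_ne i j with rfl | hij
  · exact isTest_false.congr (by simp)
  obtain ⟨P, hP⟩ := isTest_eq hi hj
  refine ⟨char (.inc j) * (P * char (.dec j)), fun s hs => ?_⟩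
  convert (hasOutcomes_inc s j).mul_unique
    ((hP _ (hs.update hj _)).mul_test (hasOutcomes_dec s j)) using 1
  ext v
  simp [hij, and_comm]

theorem isTest_ne_zero {i : ℕ} (hi : i < b) : IsTest b fun s => s i ≠ 0 :=
  (isTest_eq_add_one (hi.trans b.lt_succ_self) b.lt_succ_self).exists.congr fun s _ => by
    simp [hi.ne, Nat.exists_eq_add_one, Nat.pos_iff_ne_zero]

end IsTest

section Loop

open RegularExpression Function

/-- The relation between `y` and the possible results `z` of `m` steps that start from `y`, where
`G c x z` says that the step number `c` can lead from `x` to `z`. -/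
def Iterates (G : ℕ → ℕ → ℕ → Prop) (y : ℕ) : ℕ → ℕ → Prop
  | 0, z => z = y
  | m + 1, z => ∃ x, Iterates G y m x ∧ G m x z

/-- The state `s` during a loop, whose counter `c` and current value `x` are kept in the counters
`b` and `b + 1`. -/
def loopState (s : ℕ → ℕ) (b c x : ℕ) : ℕ → ℕ := update (update s b c) (b + 1) x

variable {b : ℕ} {s : ℕ → ℕ} {ρ : (ℕ → ℕ) → Prop}

theorem loopState_zero (hs : SupportedBelow b s) (x : ℕ) :
    loopState s b 0 x = update s (b + 1) x := by
  rw [loopState, ← hs b le_rfl, update_eq_self]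

theorem SupportedBelow.loopState (hs : SupportedBelow b s) (c x : ℕ) :
    SupportedBelow (b + 2) (loopState s b c x) :=
  ((hs.mono (by lia)).update (by lia) c).update (by lia) x

/-- The program of one step of a loop, given the program `P` that tests whether the value in the
counter `b + 2` is a possible next value. -/
def loopStep (P : RegularExpression Instr) (b : ℕ) : RegularExpression Instr :=
  (char (.inc (b + 2))).star * (P * (drain (char (.dec (b + 1))) (b + 1) *
    (drain (char (.dec (b + 2)) * char (.inc (b + 1))) (b + 2) * char (.inc b))))

theorem hasOutcomes_loopStep {P : RegularExpression Instr} (hs : SupportedBelow b s)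
    (hP : ∀ u, SupportedBelow (b + 3) u → HasOutcomes P u {v | v = u ∧ ρ u}) (c x : ℕ) :
    HasOutcomes (loopStep P b) (loopState s b c x)
      {v | ∃ z, ρ (update (loopState s b c x) (b + 2) z) ∧ v = loopState s b (c + 1) z} := by
  set u := loopState s b c x with hu
  have hub : SupportedBelow (b + 2) u := hs.loopState c x
  have hstep (z : ℕ) : HasOutcomes (drain (char (.dec (b + 1))) (b + 1) *
      (drain (char (.dec (b + 2)) * char (.inc (b + 1))) (b + 2) * char (.inc b)))
      (update u (b + 2) z) {loopState s b (c + 1) z} := by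
    refine (hasOutcomes_clear _ _).mul_unique ((hasOutcomes_move (by simp) (by simp)).mul_unique ?_)
    convert hasOutcomes_inc _ b using 2
    ext r
    simp only [hu, loopState, update_apply]
    have := hs (b + 2) (by lia)
    grind
  rw [loopStep]
  convert (hasOutcomes_guess (hub _ le_rfl)).mul
    (B := fun v => {w | ρ v ∧ w ∈ ({loopState s b (c + 1) (v (b + 2))} : Set _)}) ?_ using 1
  · ext v
    simp
  · rintro _ ⟨z, rfl⟩
    refine (hP _ ((hub.mono (by lia)).update (by lia) z)).mul_test ?_
    simpa using hstep z

theorem hasOutcomes_loop {P : RegularExpression Instr} (hs : SupportedBelow b s)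
    (hP : ∀ u, SupportedBelow (b + 3) u → HasOutcomes P u {v | v = u ∧ ρ u}) (y : ℕ) :
    HasOutcomes (loopStep P b).star (loopState s b 0 y) {v | ∃ m z,
      Iterates (fun c x z => ρ (update (loopState s b c x) (b + 2) z)) y m z ∧
        v = loopState s b m z} := by
  set G := fun c x z => ρ (update (loopState s b c x) (b + 2) z)
  convert HasOutcomes.star (B := fun m => {v | ∃ z, Iterates G y m z ∧ v = loopState s b m z})
    (C := fun u => {v | ∃ z, ρ (update u (b + 2) z) ∧ v = loopState s b (u b + 1) z})
    ?_ ?_ ?_ using 1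
  · ext v
    simp
  · rintro m _ ⟨x, -, rfl⟩
    simpa [loopState] using hasOutcomes_loopStep hs hP m x
  · simp [Iterates]
  · intro m
    ext v
    simp only [Iterates, Set.mem_ofPred_eq, Set.mem_iUnion, exists_prop]
    constructor
    · rintro ⟨z, ⟨x, hx, hz⟩, rfl⟩
      exact ⟨_, ⟨x, hx, rfl⟩, z, hz, by simp [loopState]⟩
    · rintro ⟨_, ⟨x, hx, rfl⟩, z, hz, rfl⟩
      exact ⟨z, ⟨x, hx, hz⟩, by simp [loopState]⟩

theorem hasOutcomes_clear_loopState (hs : SupportedBelow b s) (c x : ℕ) :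
    HasOutcomes (drain (char (.dec b)) b * drain (char (.dec (b + 1))) (b + 1))
      (loopState s b c x) {s} := by
  refine (hasOutcomes_clear _ _).mul_unique ?_
  convert hasOutcomes_clear _ (b + 1) using 2
  ext r
  have hzero := hs b le_rfl
  have hone := hs (b + 1) (by lia)
  simp only [loopState, update_apply]
  grind

theorem IsTest.iterates {i j k : ℕ} (hρ : IsTest (b + 3) ρ) (hi : i < b) (hj : j < b)
    (hk : k < b) : IsTest b fun s =>
      Iterates (fun c x z => ρ (update (loopState s b c x) (b + 2) z)) (s i) (s j) (s k) := by
  obtain ⟨P, hP⟩ := hρ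
  obtain ⟨Q, hQ⟩ : IsTest (b + 2) fun s => s i = s (b + 1) := isTest_eq (by lia) (by lia)
  obtain ⟨R, hR⟩ : IsTest (b + 2) fun s => s b = s j ∧ s (b + 1) = s k :=
    (isTest_eq (by lia) (by lia)).and (isTest_eq (by lia) (by lia))
  refine ⟨(char (.inc (b + 1))).star * (Q * ((loopStep P b).star *
    (R * (drain (char (.dec b)) b * drain (char (.dec (b + 1))) (b + 1))))), fun s hs => ?_⟩
  set G := fun c x z => ρ (update (loopState s b c x) (b + 2) z)
  have hexit (m z : ℕ) : HasOutcomes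
      (R * (drain (char (.dec b)) b * drain (char (.dec (b + 1))) (b + 1))) (loopState s b m z)
      {v | (m = s j ∧ z = s k) ∧ v = s} := by
    convert (hR _ (hs.loopState m z)).mul_test (hasOutcomes_clear_loopState hs m z) using 3
    simp [loopState, hj.ne, hk.ne, (hj.trans b.lt_succ_self).ne, (hk.trans b.lt_succ_self).ne]
  have hrun (y : ℕ) : HasOutcomes (Q * ((loopStep P b).star *
      (R * (drain (char (.dec b)) b * drain (char (.dec (b + 1))) (b + 1)))))
      (update s (b + 1) y) {v | s i = y ∧ v = s ∧ Iterates G y (s j) (s k)} := by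
    convert (hQ _ ((hs.mono (by lia)).update (by lia) y)).mul_test
      (((loopState_zero hs y) ▸ hasOutcomes_loop hs hP y).mul
        (B := fun u => {v | (u b = s j ∧ u (b + 1) = s k) ∧ v = s}) ?_) using 1
    · ext v
      simp only [Set.mem_ofPred_eq, Set.mem_iUnion, exists_prop,
        update_of_ne (hi.trans b.lt_succ_self).ne, update_self]
      refine and_congr_right fun _ => ⟨fun ⟨hv, h⟩ => ⟨_, ⟨_, _, h, rfl⟩, ?_⟩, ?_⟩
      · simp [loopState, hv]
      · rintro ⟨_, ⟨m, z, h, rfl⟩, ⟨hm, hz⟩, hv⟩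
        simp only [loopState, update_self, update_of_ne b.lt_succ_self.ne] at hm hz
        exact ⟨hv, hm ▸ hz ▸ h⟩
    · rintro _ ⟨m, z, -, rfl⟩
      simpa [loopState] using hexit m z
  convert (hasOutcomes_guess (hs (b + 1) (by lia))).mul
    (B := fun u => {v | s i = u (b + 1) ∧ v = s ∧ Iterates G (u (b + 1)) (s j) (s k)}) ?_ using 1
  · ext v
    simp [G]
  · rintro _ ⟨y, rfl⟩
    simpa using hrun y

end Loop

section IsGraph

open Function List.Vector RegularExpression

variable {n : ℕ}

/-- The graph of the partial function `f` can be tested by programs, whichever counters hold the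
arguments and the value. -/
def IsGraph (f : List.Vector ℕ n → Part ℕ) : Prop :=
  ∀ b (v : Fin n → ℕ) (k : ℕ), (∀ i, v i < b) → k < b →
    IsTest b fun s => s k ∈ f (ofFn fun i => s (v i))

theorem iterates_eq_iff {g : ℕ → ℕ → ℕ} {y m z : ℕ} :
    Iterates (fun c x z => z = g c x) y m z ↔ z = Nat.rec y g m := by
  induction m generalizing z with
  | zero => rfl
  | succ m ih => simp only [Iterates, ih, exists_eq_left]

theorem exists_iterates_ne_zero_iff {F : ℕ → ℕ} {y m : ℕ} :
    (∃ z, Iterates (fun c _ z => z = F c ∧ z ≠ 0) y m z) ↔ ∀ c < m, F c ≠ 0 := by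
  induction m with
  | zero => simp [Iterates]
  | succ m ih =>
    simp only [Iterates, Nat.forall_lt_succ_right, ← ih, exists_and_right]
    simp

theorem mem_mOfFn {f : Fin n → Part ℕ} {v : List.Vector ℕ n} :
    v ∈ (mOfFn f : Part (List.Vector ℕ n)) ↔ ∀ i, v.get i ∈ f i := by
  induction n with
  | zero => simp [mOfFn, Subsingleton.elim v nil]
  | succ n ih =>
    obtain ⟨x, v, rfl⟩ := v.exists_eq_cons
    have hinj (y : ℕ) (w : List.Vector ℕ n) : x ::ᵥ v = y ::ᵥ w ↔ x = y ∧ v = w := by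
      simp [List.Vector.ext_iff, Fin.forall_fin_succ]
    simp [mOfFn, ih, Fin.forall_fin_succ, hinj]

theorem isGraph_comp {m : ℕ} {f : List.Vector ℕ n → Part ℕ}
    {g : Fin n → List.Vector ℕ m → Part ℕ}
    (hf : IsGraph f) (hg : ∀ i, IsGraph (g i)) :
    IsGraph fun v => (mOfFn fun i => g i v : Part _).bind f := fun b v k hv hk => by
  have h : IsTest (b + n) fun s => (∀ i : Fin n, s (b + i) ∈ g i (ofFn fun j => s (v j))) ∧
      s k ∈ f (ofFn fun i : Fin n => s (b + i)) :=
    (isTest_forall_fin fun i => hg i _ v _ (fun j => by grind) (by lia)).and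
      (hf _ _ k (by lia) (by lia))
  refine h.exists_block.congr fun s _ => ?_
  simp only [Part.mem_bind_iff, mem_mOfFn]
  constructor
  · rintro ⟨u, hu, hgu, hfu⟩
    refine ⟨_, fun i => ?_, hu k (.inl hk) ▸ hfu⟩
    simpa [hu _ (.inl (hv _))] using hgu i
  · rintro ⟨x, hgx, hfx⟩
    refine ⟨fun r => if h : b ≤ r ∧ r < b + n then x.get ⟨r - b, by lia⟩ else s r, ?_, ?_, ?_⟩
    · intro r hr
      exact dif_neg (by lia)
    · simpa [(hv _).not_ge] using hgx
    · simpa [hk.not_ge] using hfx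

theorem isGraph_primrec {f : List.Vector ℕ n → ℕ} (hf : Nat.Primrec' f) :
    IsGraph (fun v => Part.some (f v)) := by
  induction hf with
  | zero => exact fun b v k _ _ => (isTest_eq_zero k).congr (by simp)
  | succ => exact fun b v k hv hk => (isTest_eq_add_one hk (hv 0)).congr (by simp)
  | get i => exact fun b v k hv hk => (isTest_eq hk (hv i)).congr (by simp)
  | comp g _ _ hf hg =>
    convert isGraph_comp hf hg using 2 with v
    simp
  | @prec n f g _ _ hf hg =>
    intro b v k hv hk
    have hstep := hg (b + 4) (Fin.cons (b + 1) (Fin.cons (b + 2) fun i => v i.succ)) (b + 3)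
      (by simp only [Fin.forall_fin_succ, Fin.cons_zero, Fin.cons_succ]; grind) (by lia)
    have hloop := (hf (b + 1) (fun i => v i.succ) b (by grind) (by lia)).and
      (hstep.iterates (i := b) (j := v 0) (k := k) (by lia) (by grind) (by lia))
    refine hloop.exists.congr fun s _ => ?_
    have hv' (i m) : v i ≠ b + m := by grind
    simp [loopState, ofFn, add_assoc, (hv _).ne, hk.ne, hv', iterates_eq_iff]

theorem isGraph_rfind {f : List.Vector ℕ (n + 1) → ℕ} (hf : IsGraph fun v => Part.some (f v)) :
    IsGraph fun v => Nat.rfind fun m => Part.some (decide (f (m ::ᵥ v) = 0)) := by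
  intro b v k hv hk
  have hlt {j c} (hj : j < c) (hbc : b ≤ c) : ∀ i, (Fin.cons j v : Fin (n + 1) → ℕ) i < c :=
    Fin.forall_fin_succ.2 ⟨hj, fun i => (hv i).trans_le hbc⟩
  have hzero := (hf (b + 1) (Fin.cons k v) b (hlt (by lia) (by lia)) (by lia)).and
    (isTest_eq_zero b)
  have hstep := (hf (b + 4) (Fin.cons (b + 1) v) (b + 3) (hlt (by lia) (by lia)) (by lia)).and
    (isTest_ne_zero (i := b + 3) (by lia))
  have hloop := hstep.iterates (i := k) (j := k) (k := b) (by lia) (by lia) (by lia)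
  refine (hzero.exists.and hloop.exists).congr fun s _ => ?_
  have hv' (i m) : v i ≠ b + m := by grind
  refine .trans ?_ Nat.mem_rfind.symm
  simpa [loopState, ofFn, add_assoc, (hv _).ne, hk.ne, hv'] using
    fun _ => exists_iterates_ne_zero_iff (F := fun c => f (c ::ᵥ ofFn fun i => s (v i)))

theorem isGraph_partrec {f : List.Vector ℕ n →. ℕ} (hf : Nat.Partrec' f) : IsGraph f := by
  induction hf with
  | prim hf => exact isGraph_primrec hf
  | comp g _ _ hf hg => exact isGraph_comp hf hg
  | rfind _ hf => exact isGraph_rfind hf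

theorem exists_reaches_zero_iff_dom {f : ℕ →. ℕ} (hf : Partrec f) :
    ∃ P, ∀ n : ℕ, Reaches P (Pi.single 0 n) 0 ↔ (f n).Dom := by
  have hgraph : IsTest 2 fun s => s 1 ∈ f (s 0) :=
    (isGraph_partrec (Nat.Partrec'.part_iff₁.2 hf) 2 (fun _ => 0) 1 (by simp) one_lt_two).congr
      fun s _ => by simp
  obtain ⟨P, hP⟩ := IsTest.exists (b := 1) hgraph
  refine ⟨P * drain (char (.dec 0)) 0, fun n => ?_⟩
  have hsupp : SupportedBelow 1 (Pi.single 0 n) := fun r hr => by simp [show r ≠ 0 by lia]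
  have hcast : Pi.single 0 (n : ℤ) = fun r => ((Pi.single 0 n : ℕ → ℕ) r : ℤ) := by
    ext r
    rcases eq_or_ne r 0 with rfl | hr <;> simp [*]
  rw [hcast, (hP _ hsupp).mul_test (hasOutcomes_clear _ 0) 0, Part.dom_iff_mem]
  simp [← Pi.zero_def, Pi.single]

end IsGraph

/-! ## Diverging interleavings -/

section Diverges

/-- The arguments that belong to `K` in the calls of the site `i`, where a call is a pair of a site
and an argument. -/
def track (i : ℕ) (K : Finset ℕ) (l : List (ℕ × ℕ)) : List ℕ :=
  (l.filter fun a => a.1 = i ∧ a.2 ∈ K).map Prod.snd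

/-- The sequence of calls interleaves the two sites in such a way that the arguments from `K` come
in pairs, one from each site, up to a first pair of different arguments. -/
inductive Diverges (K : Finset ℕ) : List (ℕ × ℕ) → Prop
  | skip {a l} : a.2 ∉ K → Diverges K l → Diverges K (a :: l)
  | agree {x l} : x ∈ K → Diverges K l → Diverges K ((0, x) :: (1, x) :: l)
  | differ {x y l} : x ∈ K → y ∈ K → x ≠ y → Diverges K ((0, x) :: (1, y) :: l)

variable {K : Finset ℕ}

theorem track_append (i : ℕ) (K : Finset ℕ) (l l' : List (ℕ × ℕ)) :
    track i K (l ++ l') = track i K l ++ track i K l' := by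
  simp [track]

theorem track_cons_self {i x : ℕ} (hx : x ∈ K) (l : List (ℕ × ℕ)) :
    track i K ((i, x) :: l) = x :: track i K l := by
  simp [track, hx]

theorem track_cons_of_ne {i : ℕ} {a : ℕ × ℕ} (ha : a.1 ≠ i) (l : List (ℕ × ℕ)) :
    track i K (a :: l) = track i K l := by
  simp [track, ha]

theorem track_cons_of_notMem {i : ℕ} {a : ℕ × ℕ} (ha : a.2 ∉ K) (l : List (ℕ × ℕ)) :
    track i K (a :: l) = track i K l := by
  simp [track, ha]

theorem Diverges.not_prefix {l : List (ℕ × ℕ)} (h : Diverges K l) {t : List ℕ} :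
    track 0 K l <+: t → ¬ track 1 K l <+: t := by
  induction h generalizing t with
  | skip ha _ ih => simpa only [track_cons_of_notMem ha] using ih
  | agree hx _ ih =>
    rw [track_cons_self hx, track_cons_of_ne (by simp), track_cons_of_ne (by simp),
      track_cons_self hx]
    rintro ⟨t, rfl⟩
    simpa using ih (List.prefix_append _ _)
  | differ hx hy hne =>
    rw [track_cons_self hx, track_cons_of_ne (i := 1) (by simp), track_cons_self hy]
    rintro ⟨t, rfl⟩
    simp [hne.symm]

theorem diverges_cons_iff {a : ℕ × ℕ} {l : List (ℕ × ℕ)} (ha : a.2 ∉ K ∨ a.1 ≠ 0) :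
    Diverges K (a :: l) ↔ a.2 ∉ K ∧ Diverges K l := by
  refine ⟨fun h => ?_, fun h => .skip h.1 h.2⟩
  cases h with
  | skip ha h => exact ⟨ha, h⟩
  | agree hx => simp [hx] at ha
  | differ hx => simp [hx] at ha

theorem diverges_cons_cons_iff {x : ℕ} {a : ℕ × ℕ} {l : List (ℕ × ℕ)} (hx : x ∈ K) :
    Diverges K ((0, x) :: a :: l) ↔ a.1 = 1 ∧ a.2 ∈ K ∧ (a.2 = x → Diverges K l) := by
  constructor
  · intro h
    cases h with
    | skip hx' => exact absurd hx hx'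
    | agree _ h => exact ⟨rfl, hx, fun _ => h⟩
    | differ _ hy hne => exact ⟨rfl, hy, fun heq => absurd heq.symm hne⟩
  · obtain ⟨i, y⟩ := a
    rintro ⟨rfl, hy, h⟩
    rcases eq_or_ne y x with rfl | hne
    · exact .agree hy (h rfl)
    · exact .differ hx hy hne.symm

theorem isRegular_diverges (K : Finset ℕ) : Language.IsRegular {l | Diverges K l} := by
  set L : Language (ℕ × ℕ) := {l | Diverges K l}
  have hfin : ({L, ⊤, ⊥} ∪ (fun x => L.leftQuotient [(0, x)]) '' K : Set _).Finite :=
    (Set.toFinite _).union (K.finite_toSet.image _)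
  refine isRegular_of_finite_closed hfin (by simp) ?_
  have hmem (x l) : l ∈ L.leftQuotient [x] ↔ Diverges K (x :: l) := .rfl
  rintro _ ((rfl | rfl | rfl) | ⟨x, hx, rfl⟩) a
  · by_cases ha : a.2 ∈ K
    · by_cases ha0 : a.1 = 0
      · exact .inr ⟨a.2, ha, by rw [← ha0]⟩
      · refine .inl (.inr (.inr (Language.ext fun l => ?_)))
        rw [hmem, diverges_cons_iff (.inr ha0)]
        exact iff_of_false (fun h => h.1 ha) id
    · refine .inl (.inl (Language.ext fun l => ?_))
      rw [hmem, diverges_cons_iff (.inl ha)]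
      exact and_iff_right ha
  · exact .inl (.inr (.inl rfl))
  · exact .inl (.inr (.inr rfl))
  · have hmem' (l) : l ∈ (L.leftQuotient [(0, x)]).leftQuotient [a] ↔
        a.1 = 1 ∧ a.2 ∈ K ∧ (a.2 = x → l ∈ L) := diverges_cons_cons_iff hx
    refine .inl ?_
    by_cases ha : a.1 = 1 ∧ a.2 ∈ K
    · by_cases hax : a.2 = x
      · refine .inl (Language.ext fun l => (hmem' l).trans ?_)
        exact ⟨fun h => h.2.2 hax, fun h => ⟨ha.1, ha.2, fun _ => h⟩⟩
      · refine .inr (.inl (Language.ext fun l => (hmem' l).trans ?_))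
        exact iff_of_true ⟨ha.1, ha.2, fun h => absurd h hax⟩ trivial
    · exact .inr (.inr (Language.ext fun l =>
        (hmem' l).trans (iff_of_false (fun h => ha ⟨h.1, h.2.1⟩) id)))

theorem exists_merge_diverges {β : Type*} (f : β → ℕ × ℕ) : ∀ u v : List β,
    (∀ b ∈ u, (f b).1 = 0) → (∀ b ∈ v, (f b).1 = 1) →
    (∀ t, track 0 K (u.map f) <+: t → ¬ track 1 K (v.map f) <+: t) →
    ∃ w : List β, w.filter (fun b => (f b).1 = 0) = u ∧ w.filter (fun b => (f b).1 ≠ 0) = v ∧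
      Diverges K (w.map f)
  | [], v, _, _, h => absurd List.prefix_rfl (h _ List.nil_prefix)
  | u, [], _, _, h => absurd List.nil_prefix (h _ List.prefix_rfl)
  | a :: u, b :: v, hu, hv, h => by
    obtain ⟨ha0, hu'⟩ := List.forall_mem_cons.1 hu
    obtain ⟨hb1, hv'⟩ := List.forall_mem_cons.1 hv
    by_cases ha : (f a).2 ∈ K
    · by_cases hb : (f b).2 ∈ K
      · have hfa : f a = (0, (f a).2) := Prod.ext ha0 rfl
        have hfb : f b = (1, (f b).2) := Prod.ext hb1 rfl
        obtain ⟨w, hwu, hwv, hw⟩ : ∃ w : List β, w.filter (fun b => (f b).1 = 0) = u ∧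
            w.filter (fun b => (f b).1 ≠ 0) = v ∧ ((f b).2 = (f a).2 → Diverges K (w.map f)) := by
          by_cases hba : (f b).2 = (f a).2
          · obtain ⟨w, hwu, hwv, hw⟩ := exists_merge_diverges f u v hu' hv' fun t htu htv => by
              refine h ((f a).2 :: t) ?_ ?_
              · rw [List.map_cons, hfa, track_cons_self ha]
                exact List.prefix_cons_inj _ |>.2 htu
              · rw [List.map_cons, hfb, hba, track_cons_self ha]
                exact List.prefix_cons_inj _ |>.2 htv
            exact ⟨w, hwu, hwv, fun _ => hw⟩
          · have hu0 : ∀ b ∈ u, decide ((f b).1 = 0) = true := by simpa using hu'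
            have hv0 : ∀ b ∈ v, decide ((f b).1 ≠ 0) = true := fun b hb => by simp [hv' b hb]
            refine ⟨u ++ v, ?_, ?_, fun h => absurd h hba⟩
            · simpa [List.filter_eq_self.2 hu0] using fun b hb => by simp [hv' b hb]
            · rw [List.filter_append, List.filter_eq_self.2 hv0]
              simpa using hu'
        refine ⟨a :: b :: w, by simp [ha0, hb1, hwu], by simp [ha0, hb1, ← hwv], ?_⟩
        rw [List.map_cons, List.map_cons, hfa, diverges_cons_cons_iff ha]
        exact ⟨hb1, hb, hw⟩
      · obtain ⟨w, hwu, hwv, hw⟩ := exists_merge_diverges f (a :: u) v hu hv'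
          (by simpa only [List.map_cons, track_cons_of_notMem hb] using h)
        exact ⟨b :: w, by simp [hb1, hwu], by simp [hb1, ← hwv], .skip hb hw⟩
    · obtain ⟨w, hwu, hwv, hw⟩ := exists_merge_diverges f u (b :: v) hu' hv
        (by simpa only [List.map_cons, track_cons_of_notMem ha] using h)
      exact ⟨a :: w, by simp [ha0, hwu], by simp [ha0, ← hwv], .skip ha hw⟩

theorem Diverges.append {l : List (ℕ × ℕ)} (h : Diverges K l) (l' : List (ℕ × ℕ)) :
    Diverges K (l ++ l') := by
  induction h with
  | skip ha _ ih => exact .skip ha ih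
  | agree hx _ ih => exact .agree hx ih
  | differ hx hy hne => exact .differ hx hy hne

theorem track_map_filter {β : Type*} (f : β → ℕ × ℕ) (i : ℕ) (K : Finset ℕ) (l : List β) :
    track i K ((l.filter fun b => (f b).1 = i).map f) = track i K (l.map f) := by
  simp only [track, List.filter_map, List.filter_filter, Function.comp_def]
  congr! 3
  grind

theorem exists_interleaving_diverges {β : Type*} (f : β → ℕ × ℕ) {l : List β}
    (hl : ∀ b ∈ l, (f b).1 = 0 ∨ (f b).1 = 1)
    (h : ∀ t, track 0 K (l.map f) <+: t → ¬ track 1 K (l.map f) <+: t) :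
    ∃ w : List β, (∀ i, w.filter (fun b => (f b).1 = i) = l.filter fun b => (f b).1 = i) ∧
      Diverges K (w.map f) := by
  have hne : l.filter (fun b => (f b).1 ≠ 0) = l.filter fun b => (f b).1 = 1 :=
    List.filter_congr fun b hb => by rcases hl b hb with h | h <;> simp [h]
  obtain ⟨w, hw0, hw1, hw⟩ := exists_merge_diverges (K := K) f (l.filter fun b => (f b).1 = 0)
    (l.filter fun b => (f b).1 = 1) (by simp) (by simp) (by simpa only [track_map_filter] using h)
  rw [← hne] at hw1
  refine ⟨w, fun i => ?_, hw⟩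
  by_cases hi : i = 0
  · exact hi ▸ hw0
  · have := congrArg (List.filter fun b => (f b).1 = i) hw1
    simp only [List.filter_filter] at this
    convert this using 3 with b b <;> aesop

end Diverges

/-! ## Histories of executions -/

section Histories

namespace History

variable {M D : Type} {h : History M D} {S : Spec M D}

theorem Explained.exists_enumeration {r : h.Op → h.Op → Prop} {hr : IsStrictPO r} {A K : Set h.Op}
    (H : h.Explained S r hr A K) : ∃ w ∈ S, ∃ E : List h.Op, E.Nodup ∧ (∀ x, x ∈ E ↔ x ∈ A) ∧
      E.Pairwise (fun a b => ¬ r b a) ∧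
      E.map (fun x => ((h.label x).1, (h.label x).2.1)) = w.map fun a => (a.1, a.2.1) := by
  obtain ⟨ρ, ⟨w, hw, e, he, hl⟩, hlt, hlabel⟩ := H
  refine ⟨w, hw, List.ofFn fun i => (e i : h.Op), ?_, fun x => ?_, ?_, ?_⟩
  · exact List.nodup_ofFn.2 (Subtype.val_injective.comp e.injective)
  · rw [List.mem_ofFn]
    exact ⟨fun ⟨i, hi⟩ => hi ▸ (e i).2, fun hx => ⟨e.symm ⟨x, hx⟩, by simp⟩⟩
  · rw [List.pairwise_ofFn]
    exact fun i j hij hr => lt_asymm hij ((he j i).1 (hlt _ _ hr))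
  · have hcall (o : A) : ((h.label o).1, (h.label o).2.1) = ((ρ.label o).1, (ρ.label o).2.1) := by
      have ho := hlabel o
      simp only [LPoset.full, LPoset.keepReturns, restrict] at ho
      split_ifs at ho <;> simp_all
    refine List.ext_getElem (by simp) fun i hi hi' => ?_
    simp [hcall, hl]

theorem explained_of_enumeration {r : h.Op → h.Op → Prop} {hr : IsStrictPO r} {A : Set h.Op}
    {E : List h.Op} (hE : E.Nodup) (hA : ∀ x, x ∈ E ↔ x ∈ A) (hEr : E.Pairwise r)
    (hS : E.map h.label ∈ S) (K : Set h.Op) : h.Explained S r hr A K := by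
  classical
  refine ⟨h.restrict r hr A, ⟨_, hS, (finCongr (List.length_map _)).trans
    ((List.Nodup.getEquiv E hE).trans (Equiv.subtypeEquivRight hA)), fun i j => ?_, fun i => ?_⟩,
    fun _ _ => id, fun o => ?_⟩
  · have hlt : ∀ i j : Fin E.length, i < j → r (E.get i) (E.get j) := List.pairwise_iff_get.1 hEr
    refine ⟨fun hij => ?_, fun hij => hlt _ _ hij⟩
    rcases lt_trichotomy i j with hij' | rfl | hji
    · exact hij'
    · exact absurd hij (hr.1 _)
    · exact absurd (hr.2 _ _ _ hij (hlt (finCongr (List.length_map _) j)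
        (finCongr (List.length_map _) i) hji)) (hr.1 _)
  · simp [restrict]
  · simp only [LPoset.full, LPoset.keepReturns]
    split_ifs
    · exact .inl rfl
    · exact .inr ⟨_, _, _, rfl, rfl⟩

end History

namespace Criterion

variable {M D : Type} {h : History M D} {S : Spec M D} {c : Criterion}

theorem Holds.exists_explained (H : c.Holds h S) : ∃ (co r : h.Op → h.Op → Prop)
    (hr : IsStrictPO r), (∀ a b, h.po a b → co a b) ∧
      (∀ a b, co a b → r a b) ∧ IsStrictPO co ∧
      ∀ o, ∃ K, h.Explained S r hr (h.causalPast co o) K := by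
  cases c with
  | CC =>
    obtain ⟨co, hco, hpo, H⟩ := H
    exact ⟨co, co, hco, hpo, fun _ _ => id, hco, fun o => ⟨_, H o⟩⟩
  | CM =>
    obtain ⟨co, hco, hpo, H⟩ := H
    exact ⟨co, co, hco, hpo, fun _ _ => id, hco, fun o => ⟨_, H o⟩⟩
  | CCv =>
    obtain ⟨co, arb, hco, harb, hpo, hca, H⟩ := H
    exact ⟨co, arb, harb.1, hpo, hca, hco, fun o => ⟨_, H o⟩⟩

theorem holds_of_isStrictTO {co : h.Op → h.Op → Prop} (hco : IsStrictTO co)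
    (hpo : ∀ a b, h.po a b → co a b)
    (H : ∀ o K, h.Explained S co hco.1 (h.causalPast co o) K) : c.Holds h S := by
  cases c with
  | CC => exact ⟨co, hco.1, hpo, fun o => H o _⟩
  | CM => exact ⟨co, hco.1, hpo, fun o => H o _⟩
  | CCv => exact ⟨co, co, hco.1, hco, hpo, fun _ _ => id, fun o => H o _⟩

open Classical in
theorem holds_of_enumeration {E : List h.Op} (hE : E.Nodup) (hmem : ∀ x, x ∈ E)
    (hpo : E.Pairwise fun a b => ¬ h.po b a) (hS : ∀ u, u <+: E → u.map h.label ∈ S) :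
    c.Holds h S := by
  have hto : IsStrictTO fun a b => E.idxOf a < E.idxOf b := by
    refine ⟨⟨fun a => lt_irrefl _, fun a b c => lt_trans⟩, fun a b hab => ?_⟩
    exact lt_or_gt_of_ne fun h => hab ((List.idxOf_inj (hmem a)).1 h)
  have hsorted : E.Pairwise fun a b => E.idxOf a < E.idxOf b := by
    rw [List.pairwise_iff_getElem]
    intro i j hi hj hij
    rwa [hE.idxOf_getElem, hE.idxOf_getElem]
  refine holds_of_isStrictTO hto (fun a b hab => ?_) fun o K => ?_
  · by_contra hba
    have hlt := (hto.2 a b (by rintro rfl; exact h.po_strict.1 _ hab)).resolve_left hba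
    have := List.pairwise_iff_getElem.1 hpo _ _ (List.idxOf_lt_length_iff.2 (hmem b))
      (List.idxOf_lt_length_iff.2 (hmem a)) hlt
    rw [List.getElem_idxOf, List.getElem_idxOf] at this
    exact this hab
  · have htake := E.take_prefix (E.idxOf o + 1)
    refine History.explained_of_enumeration (hE.sublist htake.sublist) (fun x => ?_)
      (hsorted.sublist htake.sublist) (hS _ htake) K
    rw [List.mem_take_iff_idxOf_lt (hmem x), Nat.lt_succ_iff_lt_or_eq, List.idxOf_inj (hmem x)]
    rfl

end Criterion

section Interleaving

variable {P M D : Type} [DecidableEq P] {S : Spec M D} {c : Criterion}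
  {e v : List (ExecLabel P M D)}

theorem exists_map_eq_of_filter_eq {α β : Type*} (f : α → β) (site : β → P) {v : List β} :
    ∀ {l : List α},
      (∀ p, v.filter (fun b => site b = p) = (l.map f).filter fun b => site b = p) →
      ∃ E : List α, E.map f = v ∧
        ∀ p, E.filter (fun a => site (f a) = p) = l.filter fun a => site (f a) = p := by
  induction v with
  | nil =>
    intro l h
    exact ⟨[], rfl, fun p => (List.map_eq_nil_iff.1 (List.filter_map.symm.trans
      (h p).symm)).symm⟩
  | cons b v ih =>
    intro l h
    obtain ⟨_, _, hl, hl₁, -, -⟩ := List.filter_eq_cons_iff.1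
      ((h (site b)).symm.trans (List.filter_cons_of_pos (by simp)))
    obtain ⟨l₁, l', rfl, rfl, hl'⟩ := List.map_eq_append_iff.1 hl
    obtain ⟨a, l₂, rfl, rfl, rfl⟩ := List.map_eq_cons_iff.1 hl'
    have hl₁' : l₁.filter (fun x => site (f x) = site (f a)) = [] := by
      simpa [List.filter_eq_nil_iff] using hl₁
    obtain ⟨E, rfl, hE⟩ := ih (l := l₁ ++ l₂) fun p => by
      have hp := h p
      by_cases hpa : site (f a) = p
      · subst hpa
        simpa [List.filter_map, Function.comp_def, hl₁'] using hp
      · simpa [List.filter_map, hpa] using hp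
    refine ⟨a :: E, rfl, fun p => ?_⟩
    by_cases hpa : site (f a) = p
    · subst hpa
      simp [hE, hl₁']
    · simp [hE, hpa]

theorem holds_execHistory_of_interleaving
    (hv : ∀ p, v.filter (fun a => a.1 = p) = e.filter fun a => a.1 = p)
    (hS : ∀ u, u <+: v → u.map Prod.snd ∈ S) : c.Holds (execHistory e) S := by
  obtain ⟨E, rfl, hE⟩ := exists_map_eq_of_filter_eq (l := List.finRange e.length) e.get Prod.fst
    (by simpa using hv)
  have hlt : E.Pairwise fun a b => (e.get a).1 = (e.get b).1 → a < b := by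
    rw [List.pairwise_iff_forall_sublist]
    intro a b hab hsite
    have hab' := hab.filter fun x => (e.get x).1 = (e.get b).1
    rw [hE] at hab'
    rw [List.filter_eq_self.2 (by simp [-List.get_eq_getElem, hsite])] at hab'
    exact List.pairwise_pair.1
      ((List.pairwise_lt_finRange _).sublist (hab'.trans List.filter_sublist))
  have hmem (x : Fin e.length) : x ∈ E := by
    have hx : x ∈ (List.finRange e.length).filter fun y => (e.get y).1 = (e.get x).1 :=
      List.mem_filter.2 ⟨List.mem_finRange _, by simp⟩
    rw [← hE] at hx
    exact List.mem_of_mem_filter hx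
  refine Criterion.holds_of_enumeration (h := execHistory e) (E := E) ?_ hmem ?_ ?_
  · exact hlt.imp fun h hab => (h (by rw [hab])).ne hab
  · exact hlt.imp fun {a b} h (hba : (e.get b).1 = (e.get a).1 ∧ b < a) =>
      lt_asymm hba.2 (h hba.1.symm)
  · intro (u : List (Fin e.length)) hu
    have := hS _ (hu.map e.get)
    rwa [List.map_map] at this

theorem prefix_of_pairwise_lt {α : Type*} [LinearOrder α] : ∀ {l₁ l₂ : List α},
    l₁.Pairwise (· < ·) → l₂.Pairwise (· < ·) → (∀ x ∈ l₁, x ∈ l₂) →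
      (∀ y ∈ l₁, ∀ x ∈ l₂, x < y → x ∈ l₁) → l₁ <+: l₂
  | [], _, _, _, _, _ => List.nil_prefix
  | a :: l₁, [], _, _, hsub, _ => absurd (hsub a List.mem_cons_self) List.not_mem_nil
  | a :: l₁, b :: l₂, h₁, h₂, hsub, hdown => by
    rw [List.pairwise_cons] at h₁ h₂
    obtain rfl : a = b := by
      rcases lt_trichotomy a b with hab | hab | hba
      · rcases List.mem_cons.1 (hsub a List.mem_cons_self) with h | h
        exacts [h, absurd (h₂.1 a h) hab.not_gt]
      · exact hab
      · rcases List.mem_cons.1 (hdown a List.mem_cons_self b List.mem_cons_self hba) with h | h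
        exacts [h.symm, absurd (h₁.1 b h) hba.not_gt]
    refine (List.prefix_cons_inj a).2 (prefix_of_pairwise_lt h₁.2 h₂.2 (fun x hx => ?_)
      fun y hy x hx hxy => ?_)
    · exact (List.mem_cons.1 (hsub x (.tail _ hx))).resolve_left (h₁.1 x hx).ne'
    · exact (List.mem_cons.1 (hdown y (.tail _ hy) x (.tail _ hx) hxy)).resolve_left
        (h₂.1 x hx).ne'

theorem Criterion.Holds.exists_interleaving (H : c.Holds (execHistory e) S)
    {a : ExecLabel P M D} (ha : a ∈ e) : ∃ w ∈ S, ∃ v : List (ExecLabel P M D),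
      v.map (fun x => (x.2.1, x.2.2.1)) = w.map (fun x => (x.1, x.2.1)) ∧ a ∈ v ∧
      ∀ p, v.filter (fun x => x.1 = p) <+: e.filter fun x => x.1 = p := by
  obtain ⟨z, rfl⟩ := List.mem_iff_get.1 ha
  obtain ⟨co, r, hr, hpo, hcor, hco, H⟩ := H.exists_explained
  obtain ⟨K, HK⟩ := H z
  obtain ⟨w, hw, (E : List (Fin e.length)), hE, hmem, hpw, hmap⟩ := HK.exists_enumeration
  have hzE : z ∈ E := (hmem z).2 (.inr rfl)
  refine ⟨w, hw, E.map e.get, ?_, List.mem_map_of_mem hzE, fun p => ?_⟩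
  · exact List.map_map.trans hmap
  have hfilter : (E.map e.get).filter (fun x => x.1 = p) =
      (E.filter fun x => (e.get x).1 = p).map e.get := by
    rw [List.filter_map]
    rfl
  have hfilter' : e.filter (fun x => x.1 = p) =
      ((List.finRange e.length).filter fun x => (e.get x).1 = p).map e.get := by
    conv_lhs => rw [← List.map_get_finRange e, List.filter_map]
    rfl
  rw [hfilter, hfilter']
  refine List.IsPrefix.map _ (prefix_of_pairwise_lt ?_
    ((List.pairwise_lt_finRange _).filter _) (fun x hx => ?_) fun y hy x hx hxy => ?_)
  · rw [List.pairwise_filter]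
    refine (hpw.and hE).imp fun {a b} ⟨hba, hne⟩ ha hb => ?_
    rw [decide_eq_true_eq] at ha hb
    exact lt_of_le_of_ne (not_lt.1 fun hlt => hba (hcor _ _ (hpo _ _ ⟨hb.trans ha.symm, hlt⟩))) hne
  · exact List.mem_filter.2 ⟨List.mem_finRange x, (List.mem_filter.1 hx).2⟩
  · simp only [List.mem_filter, decide_eq_true_eq] at hx hy ⊢
    have hxy' : co x y := hpo _ _ ⟨hx.2.trans hy.2.symm, hxy⟩
    refine ⟨(hmem x).2 (.inl ?_), hx.2⟩
    rcases (hmem y).1 hy.1 with hyz | rfl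
    exacts [hco.2 _ _ _ hxy' hyz, hxy']

end Interleaving

end Histories

/-! ## The reduction -/

section Encoding

/-- The operation label with method `i`, argument `k` and return value `0`. -/
def op (i k : ℕ) : OpLabel ℕ ℕ := (i, k, 0)

/-- The method and the argument of an operation label. In the executions below the method of an
operation is its site, so that this is a pair of a site and an argument. -/
def call (a : OpLabel ℕ ℕ) : ℕ × ℕ := (a.1, a.2.1)

namespace Instr

/-- The counter of an instruction. -/
def counter : Instr → ℕ
  | inc r | dec r | zero r => r

/-- The operations that stand for an instruction: the site `0` counts the increments and the site
`1` the decrements of the counter `r` by operations with argument `2 * r + 2`, and a test for zero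
is an operation with argument `2 * r + 3` on both sites. -/
def code : Instr → List (OpLabel ℕ ℕ)
  | inc r => [op 0 (2 * r + 2)]
  | dec r => [op 1 (2 * r + 2)]
  | zero r => [op 0 (2 * r + 3), op 1 (2 * r + 3)]

end Instr

/-- The arguments that belong to the counter `r`; the argument `0` ends the sequence of operations
of a site, whatever the counter. -/
def counterArgs (r : ℕ) : Finset ℕ := {0, 2 * r + 2, 2 * r + 3}

/-- The calls that stand for a sequence of instructions. -/
def instrCalls (w : List Instr) : List (ℕ × ℕ) := (w.flatMap Instr.code).map call

theorem Instr.mem_code_imp {i : Instr} {a : OpLabel ℕ ℕ} (ha : a ∈ i.code) :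
    (a.1 = 0 ∨ a.1 = 1) ∧ (a.2.1 = 2 * i.counter + 2 ∨ a.2.1 = 2 * i.counter + 3) := by
  cases i <;> simp only [Instr.code, List.mem_cons, List.not_mem_nil, or_false] at ha
  · simp [ha, op, Instr.counter]
  · simp [ha, op, Instr.counter]
  · rcases ha with rfl | rfl <;> simp [op, Instr.counter]

theorem track_instrCalls_cons (i r : ℕ) (j : Instr) (w : List Instr) :
    track i (counterArgs r) (instrCalls (j :: w)) =
      track i (counterArgs r) (j.code.map call) ++ track i (counterArgs r) (instrCalls w) := by
  simp [instrCalls, track_append]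

theorem track_code_of_ne {r : ℕ} {j : Instr} (h : j.counter ≠ r) (i : ℕ) :
    track i (counterArgs r) (j.code.map call) = [] := by
  cases j <;>
  · simp only [Instr.counter] at h
    simp [track, Instr.code, call, op, counterArgs]
    lia

theorem track_code_zero {i : ℕ} (hi : i = 0 ∨ i = 1) (r : ℕ) :
    track i (counterArgs r) ((Instr.zero r).code.map call) = [2 * r + 3] := by
  rcases hi with rfl | rfl <;> simp [Instr.code, call, op, track, counterArgs]

theorem replicate_append_cons_eq_iff {α : Type*} {a b : α} (hab : a ≠ b) {m n : ℕ} {u v : List α} :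
    List.replicate m a ++ b :: u = List.replicate n a ++ b :: v ↔ m = n ∧ u = v := by
  induction m generalizing n with
  | zero => cases n <;> simp [List.replicate_succ, hab.symm]
  | succ m ih => cases n <;> simp [List.replicate_succ, hab, ih]

theorem cast_sub_add_single (m n : ℕ → ℕ) (q : ℕ) : (fun r => (m r - n r : ℤ)) + Pi.single q 1 =
    fun r => (((m + Pi.single q 1 : ℕ → ℕ) r : ℕ) : ℤ) - n r := by
  ext r
  push_cast [Pi.add_apply, Pi.single_apply]
  ring

theorem cast_sub_add_single_neg (m n : ℕ → ℕ) (q : ℕ) :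
    (fun r => (m r - n r : ℤ)) + Pi.single q (-1) =
      fun r => (m r : ℤ) - (((n + Pi.single q 1 : ℕ → ℕ) r : ℕ) : ℤ) := by
  ext r
  push_cast [Pi.add_apply, Pi.single_apply]
  split_ifs <;> ring

theorem run_iff_track_eq {w : List Instr} {m n : ℕ → ℕ} :
    Run w (fun r => m r - n r) 0 ↔
      ∀ r, List.replicate (m r) (2 * r + 2) ++ track 0 (counterArgs r) (instrCalls w) =
        List.replicate (n r) (2 * r + 2) ++ track 1 (counterArgs r) (instrCalls w) := by
  induction w generalizing m n with
  | nil =>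
    simp [Run, instrCalls, track, funext_iff, sub_eq_zero, eq_comm, List.replicate_inj]
  | cons j w ih =>
    cases j with
    | inc q =>
      simp only [Run, Instr.Rel, exists_eq_left, cast_sub_add_single, ih, track_instrCalls_cons]
      refine forall_congr' fun r => ?_
      rcases eq_or_ne r q with rfl | hr
      · simp [Instr.code, call, op, track, counterArgs, List.replicate_succ']
      · simp [track_code_of_ne (j := .inc q) hr.symm, hr]
    | dec q =>
      simp only [Run, Instr.Rel, exists_eq_left, cast_sub_add_single_neg, ih,
        track_instrCalls_cons]
      refine forall_congr' fun r => ?_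
      rcases eq_or_ne r q with rfl | hr
      · simp [Instr.code, call, op, track, counterArgs, List.replicate_succ']
      · simp [track_code_of_ne (j := .dec q) hr.symm, hr]
    | zero q =>
      simp only [Run, Instr.Rel, and_assoc, exists_and_left, exists_eq_left, ih,
        track_instrCalls_cons, sub_eq_zero, Nat.cast_inj]
      rw [← forall_eq (p := fun r => m r = n r) (a' := q), ← forall_and]
      refine forall_congr' fun r => ?_
      rcases eq_or_ne r q with rfl | hr
      · rw [track_code_zero (.inl rfl), track_code_zero (.inr rfl), List.singleton_append,
          List.singleton_append, replicate_append_cons_eq_iff (by simp)]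
        simp +contextual
      · simp [track_code_of_ne (j := .zero q) hr.symm, hr]

theorem run_zero_zero_iff {w : List Instr} : Run w 0 0 ↔
    ∀ r, track 0 (counterArgs r) (instrCalls w) = track 1 (counterArgs r) (instrCalls w) := by
  simpa [Pi.zero_def] using run_iff_track_eq (w := w) (m := 0) (n := 0)

end Encoding

section FinalSpec

/-- The specification of a word that contains the final operation `op 0 1`: for some `K ∈ 𝒦` the two
sites differ on `K`. Words without this operation are allowed. -/
def finalSpec (𝒦 : Finset (Finset ℕ)) : Spec ℕ ℕ :=
  {w | (0, 1) ∈ w.map call → ∃ K ∈ 𝒦, Diverges K (w.map call)}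

theorem isRegular_finalSpec (𝒦 : Finset (Finset ℕ)) : (finalSpec 𝒦).IsRegular := by
  convert (isRegular_exists_mem fun a : OpLabel ℕ ℕ => call a = (0, 1)).compl.add
    (isRegular_exists_finset 𝒦 fun K _ => isRegular_comap call (isRegular_diverges K)) using 1
  exact Language.ext fun w => imp_iff_not_or.trans (or_congr (not_congr List.mem_map) .rfl)

/-- An operation label on the site that its method names. -/
def onSite (a : OpLabel ℕ ℕ) : ExecLabel ℕ ℕ ℕ := (a.1, a)

theorem map_snd_map_onSite (l : List (OpLabel ℕ ℕ)) : (l.map onSite).map Prod.snd = l := by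
  simp [onSite, Function.comp_def]

theorem track_prefix_track {β : Type*} (f : β → ℕ × ℕ) {v e : List β} {i : ℕ}
    (h : v.filter (fun b => (f b).1 = i) <+: e.filter fun b => (f b).1 = i) (K : Finset ℕ) :
    track i K (v.map f) <+: track i K (e.map f) := by
  rw [← track_map_filter f i K v, ← track_map_filter f i K e]
  exact ((h.map f).filter _).map _

variable {c : Criterion} {S : Spec ℕ ℕ} {𝒦 : Finset (Finset ℕ)} {Λ : Finset (OpLabel ℕ ℕ)}
  {l : List (OpLabel ℕ ℕ)}

theorem holds_of_final_notMem (hS : ∀ w, w ∈ S ↔ w ∈ finalSpec 𝒦 ∧ ∀ a ∈ w, a ∈ Λ)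
    (hΛ : ∀ a ∈ l, a ∈ Λ) (hl : (0, 1) ∉ l.map call) :
    c.Holds (execHistory (l.map onSite)) S := by
  refine holds_execHistory_of_interleaving (fun _ => rfl) fun u hu => (hS _).2 ?_
  have hul := hu.map Prod.snd
  rw [map_snd_map_onSite] at hul
  exact ⟨fun h => absurd ((hul.map call).subset h) hl, fun a ha => hΛ a (hul.subset ha)⟩

theorem exists_incomparable_of_holds (hS : S ≤ finalSpec 𝒦) (h𝒦 : ∀ K ∈ 𝒦, 1 ∉ K)
    (H : c.Holds (execHistory ((l ++ [op 0 1]).map onSite)) S) :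
    ∃ K ∈ 𝒦, ∀ t, track 0 K (l.map call) <+: t → ¬ track 1 K (l.map call) <+: t := by
  set f : ExecLabel ℕ ℕ ℕ → ℕ × ℕ := fun x => (x.1, x.2.2.1)
  have hf (u : List (OpLabel ℕ ℕ)) : (u.map onSite).map f = u.map call := List.map_map
  obtain ⟨w, hw, v, hvw, hv, hfilter⟩ := H.exists_interleaving (a := onSite (op 0 1)) (by simp)
  have hsite : ∀ x ∈ v, x.2.1 = x.1 := fun x hx => by
    have hxv : x ∈ v.filter fun y => y.1 = x.1 := by simp [hx]
    obtain ⟨a, -, rfl⟩ := List.mem_map.1 (List.mem_of_mem_filter ((hfilter x.1).subset hxv))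
    rfl
  replace hvw : v.map f = w.map call := by
    rw [← show v.map (fun x => (x.2.1, x.2.2.1)) = w.map call from hvw]
    exact List.map_congr_left fun x hx => Prod.ext (hsite x hx).symm rfl
  obtain ⟨K, hK, hdiv⟩ := hS hw (hvw ▸ List.mem_map_of_mem (f := f) hv)
  have htrack (i : ℕ) : track i K (w.map call) <+: track i K (l.map call) := by
    have := track_prefix_track f (hfilter i) K
    rwa [hvw, hf, List.map_append, track_append,
      show track i K ([op 0 1].map call) = [] from track_cons_of_notMem (h𝒦 K hK) _,
      List.append_nil] at this
  exact ⟨K, hK, fun t h0 h1 => hdiv.not_prefix ((htrack 0).trans h0) ((htrack 1).trans h1)⟩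

theorem holds_of_incomparable (hS : ∀ w, w ∈ S ↔ w ∈ finalSpec 𝒦 ∧ ∀ a ∈ w, a ∈ Λ)
    (hΛ : ∀ a ∈ l ++ [op 0 1], a ∈ Λ) (hl : ∀ a ∈ l, a.1 = 0 ∨ a.1 = 1)
    (hfinal : (0, 1) ∉ l.map call) {K : Finset ℕ} (hK : K ∈ 𝒦)
    (h : ∀ t, track 0 K (l.map call) <+: t → ¬ track 1 K (l.map call) <+: t) :
    c.Holds (execHistory ((l ++ [op 0 1]).map onSite)) S := by
  obtain ⟨w, hw, hdiv⟩ := exists_interleaving_diverges call hl h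
  have hsub : ∀ a ∈ w, a ∈ l := fun a ha => by
    have : a ∈ w.filter fun b => (call b).1 = (call a).1 := by simp [ha]
    exact List.mem_of_mem_filter (hw _ ▸ this)
  refine holds_execHistory_of_interleaving (v := (w ++ [op 0 1]).map onSite) (fun i => ?_)
    fun u hu => (hS _).2 ?_
  · have hfilter (u : List (OpLabel ℕ ℕ)) : (u.map onSite).filter (fun x => x.1 = i) =
        (u.filter fun a => (call a).1 = i).map onSite := List.filter_map
    rw [hfilter, hfilter, List.filter_append, List.filter_append, hw]
  · replace hu := hu.map Prod.snd
    rw [map_snd_map_onSite] at hu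
    refine ⟨fun hmem => ?_, fun a ha => hΛ a ?_⟩
    · rcases List.prefix_concat_iff.1 hu with h | h
      · rw [h, List.map_append]
        exact ⟨K, hK, hdiv.append _⟩
      · exact absurd (List.map_subset call (fun a ha => hsub a (h.subset ha)) hmem) hfinal
    · exact (List.mem_append.1 (hu.subset ha)).elim (fun h => List.mem_append_left _ (hsub a h))
        (List.mem_append_right _)

end FinalSpec

section Reduction

/-- The operations that stand for a sequence of instructions, followed on each site by the operation
with argument `0` that ends the sequence of the site. -/
def closedCode (w : List Instr) : List (OpLabel ℕ ℕ) :=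
  w.flatMap Instr.code ++ [op 1 0, op 0 0]

/-- The execution for a complete sequence of instructions. Its last operation `op 0 1` is the one
that makes the specification compare the two sites. -/
def completeExecution (w : List Instr) : List (ExecLabel ℕ ℕ ℕ) :=
  (closedCode w ++ [op 0 1]).map onSite

theorem mem_closedCode_imp {w : List Instr} {a : OpLabel ℕ ℕ} (ha : a ∈ closedCode w) :
    (a.1 = 0 ∨ a.1 = 1) ∧ a.2.1 ≠ 1 := by
  rcases List.mem_append.1 ha with ha | ha
  · obtain ⟨i, -, ha⟩ := List.mem_flatMap.1 ha
    have := Instr.mem_code_imp ha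
    lia
  · simp only [List.mem_cons, List.not_mem_nil, or_false] at ha
    rcases ha with rfl | rfl <;> simp [op]

theorem final_notMem_closedCode (w : List Instr) : (0, 1) ∉ (closedCode w).map call := by
  intro h
  obtain ⟨a, ha, hcall⟩ := List.mem_map.1 h
  exact (mem_closedCode_imp ha).2 (congrArg Prod.snd hcall)

theorem zero_notMem_track_instrCalls (i : ℕ) (K : Finset ℕ) (w : List Instr) :
    0 ∉ track i K (instrCalls w) := by
  intro h
  obtain ⟨b, hb, hb0⟩ := List.mem_map.1 h
  obtain ⟨a, ha, rfl⟩ := List.mem_map.1 (List.mem_of_mem_filter hb)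
  obtain ⟨j, -, ha⟩ := List.mem_flatMap.1 ha
  have := Instr.mem_code_imp ha
  simp only [call] at hb0
  lia

theorem track_instrCalls_eq_nil {r : ℕ} {w : List Instr} (h : ∀ j ∈ w, j.counter ≠ r) (i : ℕ) :
    track i (counterArgs r) (instrCalls w) = [] := by
  induction w with
  | nil => rfl
  | cons j w ih =>
    obtain ⟨hj, hw⟩ := List.forall_mem_cons.1 h
    rw [track_instrCalls_cons, track_code_of_ne hj, ih hw, List.append_nil]

theorem track_closedCode {i : ℕ} (hi : i = 0 ∨ i = 1) (r : ℕ) (w : List Instr) :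
    track i (counterArgs r) ((closedCode w).map call) =
      track i (counterArgs r) (instrCalls w) ++ [0] := by
  rw [closedCode, List.map_append, track_append]
  rcases hi with rfl | rfl <;> simp [instrCalls, track, call, op, counterArgs]

theorem forall_not_prefix_concat_iff {α : Type*} {a : α} {u v : List α} (hu : a ∉ u) (hv : a ∉ v) :
    (∀ t, u ++ [a] <+: t → ¬ v ++ [a] <+: t) ↔ u ≠ v := by
  have heq {u v : List α} (hv : a ∉ v) (h : u ++ [a] <+: v ++ [a]) : u = v := by
    rcases List.prefix_concat_iff.1 h with h | h
    · exact (List.append_left_inj [a]).1 h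
    · exact absurd (h.subset (by simp)) hv
  constructor
  · rintro h rfl
    exact h _ List.prefix_rfl List.prefix_rfl
  · intro hne t hut hvt
    rcases List.prefix_or_prefix_of_prefix hut hvt with h | h
    exacts [hne (heq hv h), hne (heq hu h).symm]

theorem incomparable_closedCode_iff {r : ℕ} {w : List Instr} :
    (∀ t, track 0 (counterArgs r) ((closedCode w).map call) <+: t →
      ¬ track 1 (counterArgs r) ((closedCode w).map call) <+: t) ↔
      track 0 (counterArgs r) (instrCalls w) ≠ track 1 (counterArgs r) (instrCalls w) := by
  rw [track_closedCode (.inl rfl), track_closedCode (.inr rfl)]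
  exact forall_not_prefix_concat_iff (zero_notMem_track_instrCalls _ _ _)
    (zero_notMem_track_instrCalls _ _ _)

/-- The labels that occur in the executions for instructions from `Γ`. -/
def alphabet (Γ : Finset Instr) : Finset (OpLabel ℕ ℕ) :=
  Γ.biUnion (fun i => i.code.toFinset) ∪ {op 1 0, op 0 0, op 0 1}

/-- The sets of arguments that belong to the counters of the instructions from `Γ`. -/
def tracks (Γ : Finset Instr) : Finset (Finset ℕ) := Γ.image fun i => counterArgs i.counter

section Holds

variable {c : Criterion} {S : Spec ℕ ℕ} {Γ : Finset Instr} {w : List Instr}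

theorem mem_alphabet (hw : ∀ i ∈ w, i ∈ Γ) : ∀ a ∈ closedCode w ++ [op 0 1], a ∈ alphabet Γ := by
  intro a ha
  simp only [closedCode, List.mem_append, List.mem_flatMap, List.mem_cons, List.not_mem_nil,
    or_false, or_assoc] at ha
  simp only [alphabet, Finset.mem_union, Finset.mem_biUnion, List.mem_toFinset, Finset.mem_insert,
    Finset.mem_singleton]
  exact ha.imp_left fun ⟨i, hi, ha⟩ => ⟨i, hw i hi, ha⟩

theorem holds_completeExecution_iff
    (hS : ∀ w, w ∈ S ↔ w ∈ finalSpec (tracks Γ) ∧ ∀ a ∈ w, a ∈ alphabet Γ)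
    (hw : ∀ i ∈ w, i ∈ Γ) : c.Holds (execHistory (completeExecution w)) S ↔ ¬ Run w 0 0 := by
  rw [run_zero_zero_iff, not_forall]
  constructor
  · intro H
    obtain ⟨K, hK, h⟩ := exists_incomparable_of_holds (fun w hw => ((hS w).1 hw).1)
      (by simp [tracks, counterArgs]) H
    obtain ⟨j, -, rfl⟩ := Finset.mem_image.1 hK
    exact ⟨j.counter, incomparable_closedCode_iff.1 h⟩
  · rintro ⟨r, hr⟩
    have hrK : counterArgs r ∈ tracks Γ := by
      by_contra hrK
      refine hr ?_
      have hne : ∀ j ∈ w, j.counter ≠ r := fun j hj hjr =>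
        hrK (Finset.mem_image.2 ⟨j, hw j hj, by rw [hjr]⟩)
      rw [track_instrCalls_eq_nil hne, track_instrCalls_eq_nil hne]
    exact holds_of_incomparable hS (mem_alphabet hw) (fun a ha => (mem_closedCode_imp ha).1)
      (final_notMem_closedCode w) hrK (incomparable_closedCode_iff.2 hr)

theorem holds_of_prefix_closedCode
    (hS : ∀ w, w ∈ S ↔ w ∈ finalSpec (tracks Γ) ∧ ∀ a ∈ w, a ∈ alphabet Γ)
    (hw : ∀ i ∈ w, i ∈ Γ) {e : List (ExecLabel ℕ ℕ ℕ)} (he : e <+: (closedCode w).map onSite) :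
    c.Holds (execHistory e) S := by
  obtain ⟨l, hl, rfl⟩ := List.prefix_map_iff.1 he
  exact holds_of_final_notMem hS
    (fun a ha => mem_alphabet hw a (List.mem_append_left _ (hl.subset ha)))
    fun h => final_notMem_closedCode w ((hl.map call).subset h)

end Holds

/-- The executions for the complete sequences of instructions that match `P`. -/
def completeExecutions (P : RegularExpression Instr) : Language (ExecLabel ℕ ℕ ℕ) :=
  {x | ∃ w ∈ P.matches', completeExecution w = x}

theorem isRegular_completeExecutions (P : RegularExpression Instr) :
    (completeExecutions P).IsRegular := by
  suffices completeExecutions P = substWords (fun i => i.code.map onSite) P.matches' *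
      {[op 1 0, op 0 0, op 0 1].map onSite} from
    this ▸ isRegular_mul (isRegular_substWords_matches' (fun i => i.code.map onSite) P)
    (isRegular_singleton _)
  have hcomplete (w : List Instr) : completeExecution w =
      w.flatMap (fun i => i.code.map onSite) ++ [op 1 0, op 0 0, op 0 1].map onSite := by
    simp [completeExecution, closedCode, List.map_flatMap]
  ext x
  constructor
  · rintro ⟨w, hw, rfl⟩
    exact ⟨_, ⟨w, hw, rfl⟩, _, rfl, (hcomplete w).symm⟩
  · rintro ⟨_, ⟨w, hw, rfl⟩, _, rfl, rfl⟩
    exact ⟨w, hw, hcomplete w⟩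

theorem completeExecution_append (v w : List Instr) :
    completeExecution (v ++ w) = (v.flatMap Instr.code).map onSite ++ completeExecution w := by
  simp [completeExecution, closedCode]

theorem map_onSite_flatMap_code_replicate_inc (n : ℕ) :
    ((List.replicate n (Instr.inc 0)).flatMap Instr.code).map onSite =
      List.replicate n (onSite (op 0 2)) := by
  induction n with
  | zero => rfl
  | succ n ih => simpa [List.replicate_succ, Instr.code] using ih

theorem exists_computable_executions (P : RegularExpression Instr) :
    ∃ 𝒜 : ℕ → FinAutomaton (ExecLabel ℕ ℕ ℕ), Computable 𝒜 ∧ ∀ n e, e ∈ (𝒜 n).language ↔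
      e <+: ((List.replicate n (Instr.inc 0)).flatMap Instr.code).map onSite ∨
      ∃ w ∈ P.matches', e <+: completeExecution (List.replicate n (.inc 0) ++ w) := by
  obtain ⟨Γ, hΓ⟩ := exists_finset_forall_mem_matches' P
  let L : Language (ExecLabel ℕ ℕ ℕ) := {[]} + completeExecutions P
  have hreg : L.IsRegular := (isRegular_singleton []).add (isRegular_completeExecutions P)
  have hletters : ∀ w ∈ L, ∀ a ∈ w, a ∈ (alphabet Γ).image onSite := by
    rintro _ (rfl | ⟨w, hw, rfl⟩) a ha
    · exact absurd ha List.not_mem_nil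
    · obtain ⟨b, hb, rfl⟩ := List.mem_map.1 ha
      exact Finset.mem_image_of_mem _ (mem_alphabet (hΓ w hw) b hb)
  obtain ⟨𝒜, h𝒜⟩ := FinAutomaton.exists_language_eq (isRegular_prefixes hreg)
    ((alphabet Γ).image onSite)
  have hprefix : 𝒜.language = {x | ∃ w ∈ L, x <+: w} :=
    h𝒜.trans <| Set.ext fun x =>
      and_iff_left_of_imp fun ⟨w, hw, hx⟩ a ha => hletters w hw a (hx.subset ha)
  refine ⟨_, FinAutomaton.computable_prepend_iterate (onSite (op 0 2)) 𝒜, fun n e => ?_⟩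
  rw [FinAutomaton.mem_language_prepend_iterate hprefix ⟨[], .inl rfl⟩]
  simp only [completeExecution_append, map_onSite_flatMap_code_replicate_inc]
  constructor
  · rintro ⟨_, rfl | ⟨w, hw, rfl⟩, he⟩
    · exact .inl (by rwa [List.append_nil] at he)
    · exact .inr ⟨w, hw, he⟩
  · rintro (he | ⟨w, hw, he⟩)
    · exact ⟨[], .inl rfl, by rwa [List.append_nil]⟩
    · exact ⟨_, .inr ⟨w, hw, rfl⟩, he⟩

theorem run_replicate_inc_append_iff {n : ℕ} {w : List Instr} :
    Run (List.replicate n (.inc 0) ++ w) 0 0 ↔ Run w (Pi.single 0 n) 0 := by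
  simp [run_append, run_replicate_inc]

theorem eq_zero_or_one_of_mem_completeExecution {w : List Instr} {a : ExecLabel ℕ ℕ ℕ}
    (ha : a ∈ completeExecution w) : a.1 = 0 ∨ a.1 = 1 := by
  obtain ⟨b, hb, rfl⟩ := List.mem_map.1 ha
  rcases List.mem_append.1 hb with hb | hb
  · exact (mem_closedCode_imp hb).1
  · exact .inl (congrArg Prod.fst (List.mem_singleton.1 hb))

theorem map_onSite_flatMap_code_prefix (w : List Instr) :
    (w.flatMap Instr.code).map onSite <+: (closedCode w).map onSite :=
  (List.prefix_append _ _).map _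

theorem forall_holds_iff {c : Criterion} {S : Spec ℕ ℕ} {Γ : Finset Instr}
    (hS : ∀ w, w ∈ S ↔ w ∈ finalSpec (tracks Γ) ∧ ∀ a ∈ w, a ∈ alphabet Γ)
    {w : List Instr} (hw : ∀ i ∈ w, i ∈ Γ) :
    (∀ e, e <+: completeExecution w → c.Holds (execHistory e) S) ↔ ¬ Run w 0 0 := by
  rw [← holds_completeExecution_iff hS hw]
  refine ⟨fun H => H _ List.prefix_rfl, fun H e he => ?_⟩
  rw [completeExecution, List.map_append, List.map_singleton, List.prefix_concat_iff] at he
  rcases he with rfl | he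
  · simpa [completeExecution] using H
  · exact holds_of_prefix_closedCode hS hw he

theorem exists_reduction {f : ℕ →. ℕ} (hf : Partrec f) : ∃ g : ℕ → Input, Computable g ∧
    ∀ n, ValidInput (g n) ∧ TwoSites (g n) ∧ ∀ c, AllExecutions c (g n) ↔ ¬ (f n).Dom := by
  classical
  obtain ⟨P, hP⟩ := exists_reaches_zero_iff_dom hf
  obtain ⟨𝒜, hcomp, h𝒜⟩ := exists_computable_executions P
  obtain ⟨Γ, hΓ⟩ := exists_finset_forall_mem_matches' P
  set Γ' := insert (.inc 0) Γ
  obtain ⟨𝒮, h𝒮⟩ := FinAutomaton.exists_language_eq (isRegular_finalSpec (tracks Γ')) (alphabet Γ')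
  have hS : ∀ w, w ∈ 𝒮.language ↔ w ∈ finalSpec (tracks Γ') ∧ ∀ a ∈ w, a ∈ alphabet Γ' :=
    Set.ext_iff.1 h𝒮
  have hinc (n : ℕ) : ∀ i ∈ List.replicate n (Instr.inc 0), i ∈ Γ' := fun i hi =>
    List.eq_of_mem_replicate hi ▸ Finset.mem_insert_self _ _
  have hprogram (n : ℕ) {w} (hw : w ∈ P.matches') :
      ∀ i ∈ List.replicate n (.inc 0) ++ w, i ∈ Γ' := fun i hi =>
    (List.mem_append.1 hi).elim (hinc n i) fun hi => Finset.mem_insert_of_mem (hΓ w hw i hi)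
  refine ⟨fun n => (𝒜 n, 𝒮), hcomp.pair (.const 𝒮), fun n => ⟨?_, ?_, fun c => ?_⟩⟩
  · intro e e' he
    simp only [h𝒜] at he ⊢
    have hprefix := List.prefix_append e e'
    exact he.imp hprefix.trans (Exists.imp fun w => And.imp_right hprefix.trans)
  · intro e he a ha
    rcases (h𝒜 n e).1 he with he | ⟨w, -, he⟩
    · exact eq_zero_or_one_of_mem_completeExecution
        (((he.trans (map_onSite_flatMap_code_prefix _)).trans
          ((List.prefix_append _ _).map _)).subset ha)
    · exact eq_zero_or_one_of_mem_completeExecution (he.subset ha)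
  · rw [← hP, Reaches, not_exists]
    simp only [not_and, ← run_replicate_inc_append_iff]
    constructor
    · intro H w hw
      exact (forall_holds_iff hS (hprogram n hw)).1 fun e he => H e ((h𝒜 n e).2 (.inr ⟨w, hw, he⟩))
    · intro H e he
      rcases (h𝒜 n e).1 he with he | ⟨w, hw, he⟩
      · exact holds_of_prefix_closedCode hS (hinc n) (he.trans (map_onSite_flatMap_code_prefix _))
      · exact (forall_holds_iff hS (hprogram n hw)).2 (H w hw) e he

end Reduction

theorem not_decidableOn_allExecutions (c : Criterion) {V : Input → Prop}
    (hV : ∀ x, ValidInput x → TwoSites x → V x) : ¬ DecidableOn V (AllExecutions c) := by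
  rintro ⟨F, hF, hFV⟩
  have heval : Partrec fun n => (Denumerable.ofNat Nat.Partrec.Code n).eval 0 :=
    Nat.Partrec.Code.eval_part.comp (Computable.ofNat Nat.Partrec.Code) (Computable.const 0)
  obtain ⟨g, hg, H⟩ := exists_reduction heval
  have hhalts : Partrec fun code : Nat.Partrec.Code =>
      (F (g (Encodable.encode code))).map fun b => !b :=
    (hF.comp (hg.comp Computable.encode)).map (Primrec.not.to_comp.comp Computable.snd)
  classical
  refine ComputablePred.halting_problem 0 ⟨fun _ => Classical.propDecidable _,
    hhalts.of_eq fun code => ?_⟩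
  obtain ⟨hvalid, hsites, hiff⟩ := H (Encodable.encode code)
  obtain ⟨b, hb, hbQ⟩ := hFV _ (hV _ hvalid hsites)
  rw [hiff c, Denumerable.ofNat_encode] at hbQ
  rw [Part.eq_some_iff.2 hb, Part.map_some, PFun.coe_val, Part.some_inj]
  cases b <;> simp_all

theorem mainTheorem6 (c : Criterion) :
    ¬ DecidableOn ValidInput (AllExecutions c) ∧
    ¬ DecidableOn (fun x => ValidInput x ∧ TwoSites x) (AllExecutions c) :=
  ⟨not_decidableOn_allExecutions c fun _ h _ => h,
    not_decidableOn_allExecutions c fun _ h h' => ⟨h, h'⟩⟩
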